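/- Conventions. Modules are left modules. For a ring $\Lambda$, $\operatorname{pr}\Lambda$ is the category of finitely generated projective $\Lambda$-modules, and $\operatorname{gl.dim}\Lambda\le 2$ means that every $\Lambda$-module has projective dimension at most $2$. A subcategory of an additive category is a full subcategory closed under isomorphisms, finite direct sums and direct summands. For a subcategory $\mathcal C'$ of an additive category $\mathcal C$, $[\mathcal C']$ is the ideal of $\mathcal C$ of all morphisms that factor through an object of $\mathcal C'$. The subcategory $\mathcal C'$ is called right rejective in $\mathcal C$ if for every $X\in\mathcal C$ there is a monomorphism $f:Y\to X$ of $\mathcal C$ that lies in $[\mathcal C']$ and through which every morphism of $[\mathcal C']$ with target $X$ factors. A right rejective chain from $\mathcal C$ to $\mathcal C'$ is a chain of subcategories $\mathcal C'=\mathcal C_m\subseteq\mathcal C_{m-1}\subseteq\dots\subseteq\mathcal C_0=\mathcal C$ ($m\ge 0$) such that for all $0\le n<m$ the subcategory $\mathcal C_{n+1}$ is right rejective in $\mathcal C$ and the Jacobson radical of the factor category $\mathcal C_n/[\mathcal C_{n+1}]$ is zero. An artin algebra is an algebra that is finitely generated as a module over a commutative artinian ring. Let $R$ be a complete discrete valuation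 ring with quotient field $K$. An $R$-order is an $R$-algebra that is finitely generated projective as an $R$-module. For an $R$-order $\Lambda$ put $A=\Lambda\otimes_RK\supseteq\Lambda$. An overorder of $\Lambda$ is an $R$-order $\Gamma$ with $\Lambda\subseteq\Gamma\subseteq A$; it is called maximal if no $R$-order in $A$ contains it properly. A $\Gamma$-lattice is a $\Gamma$-module that is finitely generated projective over $R$, and the category $\operatorname{lat}\Gamma$ of $\Gamma$-lattices is regarded, by restriction of scalars, as a full subcategory of the category of $\Lambda$-modules. Theorem. (1) If $\Lambda$ is an artin algebra with $\operatorname{gl.dim}\Lambda\le 2$, then there is a right rejective chain from $\operatorname{pr}\Lambda$ to $0$. (2) If $\Lambda$ is an $R$-order such that $A=\Lambda\otimes_RK$ is semisimple and $\operatorname{gl.dim}\Lambda\le 2$, then there is a maximal overorder $\Gamma$ of $\Lambda$ such that $\operatorname{lat}\Gamma\subseteq\operatorname{pr}\Lambda$ and there is a right rejective chain from $\operatorname{pr}\Lambda$ to $\operatorname{lat}\Gamma$. -/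

import Mathlib

open CategoryTheory CategoryTheory.Limits
open scoped TensorProduct

universe v u u₁ u₂

/-! ### Ideals and factor categories of preadditive categories -/

/-- A two-sided ideal of a preadditive category `C`: a subgroup of every `Hom(X, Y)`, stable under
composition with arbitrary morphisms on both sides. -/
structure CatIdeal (C : Type u) [Category.{v} C] [Preadditive C] where
  hom : ∀ X Y : C, AddSubgroup (X ⟶ Y)
  comp_mem : ∀ {W X Y Z : C} (f : W ⟶ X) (g : X ⟶ Y) (h : Y ⟶ Z),
    g ∈ hom X Y → f ≫ g ≫ h ∈ hom W Z

namespace CatIdeal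

variable {C : Type u} [Category.{v} C] [Preadditive C]

/-- Two parallel morphisms are identified when their difference lies in the ideal. -/
def rel (I : CatIdeal C) : HomRel C := fun X Y f g => f - g ∈ I.hom X Y

instance congruence (I : CatIdeal C) : Congruence I.rel where
  comp_left {X Y Z} f {g g'} h := by
    have := I.comp_mem f (g - g') (𝟙 Z) h
    simpa [rel, Preadditive.comp_sub] using this
  comp_right {X Y Z} {f f'} g h := by
    have := I.comp_mem (𝟙 X) (f - f') g h
    simpa [rel, Preadditive.sub_comp] using this
  equivalence {X Y} :=
    { refl := fun f => by simp [rel, (I.hom X Y).zero_mem]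
      symm := fun {f g} h => by
        have := (I.hom X Y).neg_mem h
        simpa [rel] using this
      trans := fun {f g k} h h' => by
        have := (I.hom X Y).add_mem h h'
        simpa [rel] using this }

/-- The factor category `C / I`: same objects, and `(C / I)(X, Y) = C(X, Y) / I(X, Y)`. -/
abbrev Factor (I : CatIdeal C) : Type u := CategoryTheory.Quotient I.rel

instance factorPreadditive (I : CatIdeal C) : Preadditive I.Factor :=
  CategoryTheory.Quotient.preadditive I.rel (fun X Y f₁ f₂ g₁ g₂ hf hg => by
    have := (I.hom X Y).add_mem hf hg
    have e : f₁ + g₁ - (f₂ + g₂) = f₁ - f₂ + (g₁ - g₂) := by abel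
    simpa [rel, e] using this)

/-- Restriction of an ideal to a full subcategory. -/
def restrict (I : CatIdeal C) (P : ObjectProperty C) : CatIdeal P.FullSubcategory where
  hom X Y :=
    { carrier := {f | f.hom ∈ I.hom X.obj Y.obj}
      add_mem' := fun ha hb => (I.hom _ _).add_mem ha hb
      zero_mem' := (I.hom _ _).zero_mem
      neg_mem' := fun ha => (I.hom _ _).neg_mem ha }
  comp_mem f g h hg := I.comp_mem f.hom g.hom h.hom hg

/-- The morphism `f : Y ⟶ X` is a right `I`-approximation of `X`: it lies in `I`, and every
morphism of `I` with target `X` factors through `f`. -/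
def IsRightApprox (I : CatIdeal C) {Y X : C} (f : Y ⟶ X) : Prop :=
  f ∈ I.hom Y X ∧ ∀ (Z : C) (g : Z ⟶ X), g ∈ I.hom Z X → ∃ h : Z ⟶ Y, h ≫ f = g

end CatIdeal

section Jacobson

variable (C : Type u) [Category.{v} C] [Preadditive C]

/-- In a ring, an element of the Jacobson radical becomes one-sided invertible after adding `1`;
stated in an endomorphism ring, where multiplication is the opposite of composition. -/
theorem exists_comp_eq_of_mem_jacobson {X : C} (a : X ⟶ X)
    (ha : (a : End X) ∈ Ring.jacobson (End X)) : ∃ t : X ⟶ X, (𝟙 X + a) ≫ t = 𝟙 X := by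
  rw [← Ideal.jacobson_bot] at ha
  obtain ⟨z, hz⟩ := (Ideal.mem_jacobson_iff (R := End X)).mp ha (1 : End X)
  let z' : X ⟶ X := z
  refine ⟨z', ?_⟩
  rw [mul_one] at hz
  have h2 : a ≫ z' + z' - 𝟙 X = 0 := (Ideal.mem_bot (R := End X)).mp hz
  rw [Preadditive.add_comp, Category.id_comp, add_comm]
  exact sub_eq_zero.mp h2

/-- The Jacobson radical of a preadditive category: `J(X, Y)` consists of the `f : X ⟶ Y` such that
`f ≫ g` lies in the Jacobson radical of the ring `End X` for every `g : Y ⟶ X`. -/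
def catJacobson : CatIdeal C where
  hom X Y :=
    { carrier := {f | ∀ g : Y ⟶ X, (f ≫ g : End X) ∈ Ring.jacobson (End X)}
      add_mem' := fun {a b} ha hb g => by
        rw [Preadditive.add_comp]
        exact (Ring.jacobson (End X)).add_mem (ha g) (hb g)
      zero_mem' := fun g => by
        rw [zero_comp]
        exact (Ring.jacobson (End X)).zero_mem
      neg_mem' := fun {a} ha g => by
        rw [Preadditive.neg_comp]
        exact (Ring.jacobson (End X)).neg_mem (ha g) }
  comp_mem {W X Y Z} p f q hf g := by
    rw [← Ideal.jacobson_bot]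
    refine (Ideal.mem_jacobson_iff (R := End W)).mpr fun y => ?_
    let c : X ⟶ W := f ≫ q ≫ g ≫ (y : W ⟶ W)
    have h1 : (c ≫ p : End X) ∈ Ring.jacobson (End X) := by
      have := hf (q ≫ g ≫ (y : W ⟶ W) ≫ p)
      simpa [c] using this
    obtain ⟨t, ht⟩ := exists_comp_eq_of_mem_jacobson C _ h1
    refine ⟨(𝟙 W - p ≫ t ≫ c : W ⟶ W), ?_⟩
    refine (Ideal.mem_bot (R := End W)).mpr ?_
    have h2 : t + c ≫ p ≫ t = 𝟙 X := by
      simpa [Preadditive.add_comp] using ht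
    have h3 : c ≫ p ≫ t = 𝟙 X - t := by rw [← h2]; abel
    have h4 : (p ≫ c) ≫ (𝟙 W - p ≫ t ≫ c) + (𝟙 W - p ≫ t ≫ c) - 𝟙 W = 0 := by
      have h5 : (p ≫ c) ≫ (p ≫ t ≫ c) = p ≫ (c ≫ p ≫ t) ≫ c := by simp
      rw [Preadditive.comp_sub, h5, h3]
      simp
    have h6 : ((p ≫ f ≫ q) ≫ g) ≫ (y : W ⟶ W) = p ≫ c := by simp [c]
    rw [← h6, Category.assoc ((p ≫ f ≫ q) ≫ g)] at h4
    exact h4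

/-- On the diagonal, `catJacobson` is the usual Jacobson radical of the endomorphism ring. -/
theorem mem_catJacobson_self {X : C} (f : X ⟶ X) :
    f ∈ (catJacobson C).hom X X ↔ (f : End X) ∈ Ring.jacobson (End X) := by
  constructor
  · intro h
    have := h (𝟙 X)
    simpa using this
  · intro h g
    exact (Ring.jacobson (End X)).smul_mem (g : End X) h

/-- The condition `J_C = 0`. -/
def HasZeroJacobson : Prop := ∀ X Y : C, (catJacobson C).hom X Y = ⊥

end Jacobson

/-! ### Subcategories, right rejective subcategories, right rejective chains -/

/-- A full subcategory closed under isomorphisms, (finite) direct sums and direct summands. -/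
structure AddSubcat (C : Type u) [Category.{v} C] [Preadditive C] [HasBinaryBiproducts C] where
  obj : ObjectProperty C
  of_iso : ∀ {X Y : C}, (X ≅ Y) → obj X → obj Y
  of_isZero : ∀ {X : C}, IsZero X → obj X
  biprod : ∀ {X Y : C}, obj X → obj Y → obj (X ⊞ Y)
  summand : ∀ {X Y : C}, obj (X ⊞ Y) → obj X

namespace AddSubcat

variable {C : Type u} [Category.{v} C] [Preadditive C] [HasZeroObject C] [HasBinaryBiproducts C]

/-- The ideal `[D]` of all morphisms of `C` that factor through some object of `D`. -/
def ideal (D : AddSubcat C) : CatIdeal C where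
  hom X Y :=
    { carrier := {f | ∃ (Z : C) (g : X ⟶ Z) (h : Z ⟶ Y), D.obj Z ∧ g ≫ h = f}
      add_mem' := by
        rintro a b ⟨Z, g, h, hZ, rfl⟩ ⟨Z', g', h', hZ', rfl⟩
        exact ⟨Z ⊞ Z', biprod.lift g g', biprod.desc h h', D.biprod hZ hZ', by simp⟩
      zero_mem' := by
        obtain ⟨Z, hZ⟩ := HasZeroObject.zero (C := C)
        exact ⟨Z, 0, 0, D.of_isZero hZ, by simp⟩
      neg_mem' := by
        rintro a ⟨Z, g, h, hZ, rfl⟩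
        exact ⟨Z, -g, h, hZ, by simp⟩ }
  comp_mem := by
    rintro W X Y Z p f q ⟨T, g, h, hT, rfl⟩
    exact ⟨T, p ≫ g, h ≫ q, hT, by simp⟩

/-- `D` is a right rejective subcategory of `C`: every object of `C` has a right `[D]`-approximation
which is a monomorphism of `C`. -/
def IsRightRejective (D : AddSubcat C) : Prop :=
  ∀ X : C, ∃ (Y : C) (f : Y ⟶ X), Mono f ∧ D.ideal.IsRightApprox f

/-- The factor category `D / [D']` of the full subcategory `D`, for `D' ⊆ D` (for such `D'` a
morphism of `D` factors through `D'` in `C` if and only if it does so in `D`). -/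
abbrev FactorBy (D D' : AddSubcat C) : Type u := (D'.ideal.restrict D.obj).Factor

end AddSubcat

/-- There is a right rejective chain `T = C_m ⊆ ⋯ ⊆ C_1 ⊆ C_0 = C` from `C` to the full
subcategory on the objects satisfying `T`. -/
def HasRightRejectiveChain (C : Type u) [Category.{v} C] [Preadditive C] [HasZeroObject C]
    [HasBinaryBiproducts C] (T : ObjectProperty C) : Prop :=
  ∃ (m : ℕ) (D : ℕ → AddSubcat C),
    (∀ X : C, (D 0).obj X) ∧
    (D m).obj = T ∧
    ∀ n < m,
      (D (n + 1)).obj ≤ (D n).obj ∧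
      HasZeroJacobson ((D n).FactorBy (D (n + 1))) ∧
      (D (n + 1)).IsRightRejective

/-! ### Finitely generated projective modules, orders, lattices -/

/-- Finitely generated projective left `Λ`-modules. -/
def prProperty (Λ : Type u) [Ring Λ] : ObjectProperty (ModuleCat.{u} Λ) :=
  fun X => Module.Finite Λ X ∧ Module.Projective Λ X

/-- The category `pr Λ` of finitely generated projective left `Λ`-modules. -/
abbrev Pr (Λ : Type u) [Ring Λ] : Type (u + 1) := (prProperty Λ).FullSubcategory

instance Pr.hasZeroObject (Λ : Type u) [Ring Λ] : HasZeroObject (Pr Λ) where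
  zero := by
    refine ⟨⟨ModuleCat.of Λ PUnit, by constructor <;> infer_instance⟩, ?_⟩
    rw [IsZero.iff_id_eq_zero]
    ext

instance Pr.hasBinaryBiproducts (Λ : Type u) [Ring Λ] : HasBinaryBiproducts (Pr Λ) where
  has_binary_biproduct X Y := by
    obtain ⟨X, hX1, hX2⟩ := X
    obtain ⟨Y, hY1, hY2⟩ := Y
    let b : BinaryBicone (C := Pr Λ) ⟨X, hX1, hX2⟩ ⟨Y, hY1, hY2⟩ :=
      { pt := ⟨ModuleCat.of Λ (X × Y), by constructor <;> infer_instance⟩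
        fst := ObjectProperty.homMk (ModuleCat.ofHom (LinearMap.fst Λ X Y))
        snd := ObjectProperty.homMk (ModuleCat.ofHom (LinearMap.snd Λ X Y))
        inl := ObjectProperty.homMk (ModuleCat.ofHom (LinearMap.inl Λ X Y))
        inr := ObjectProperty.homMk (ModuleCat.ofHom (LinearMap.inr Λ X Y))
        inl_fst := by ext x; rfl
        inl_snd := by ext x; rfl
        inr_fst := by ext x; rfl
        inr_snd := by ext x; rfl }
    refine hasBinaryBiproduct_of_total b ?_
    apply ObjectProperty.hom_ext
    apply ModuleCat.hom_ext
    apply LinearMap.ext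
    rintro ⟨x, y⟩
    change ((x, 0) : X × Y) + (0, y) = (x, y)
    simp

/-- Every left `Λ`-module has projective dimension at most `d`. -/
def GlobalDimLE (Λ : Type u) [Ring Λ] (d : ℕ) : Prop :=
  ∀ X : ModuleCat.{u} Λ, HasProjectiveDimensionLE X d

section Orders

variable (R : Type u₁) [CommRing R] (K : Type u₂) [Field K] [Algebra R K]
  (Λ : Type u) [Ring Λ] [Algebra R Λ]

/-- An `R`-order: an `R`-algebra which is a finitely generated projective `R`-module. -/
def IsROrder (Γ : Type*) [Ring Γ] [Algebra R Γ] : Prop :=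
  Module.Finite R Γ ∧ Module.Projective R Γ

/-- An overorder of `Λ`: an `R`-order `Γ` with `Λ ⊆ Γ ⊆ A`, where `A = Λ ⊗[R] K`. -/
structure Overorder where
  carrier : Subalgebra R (Λ ⊗[R] K)
  isROrder : IsROrder R carrier
  le : (Algebra.TensorProduct.includeLeft : Λ →ₐ[R] Λ ⊗[R] K).range ≤ carrier

namespace Overorder

variable {R K Λ}

/-- The order `Γ` is maximal: no `R`-order in `A` contains it properly. -/
def IsMaximalOrder (Γ : Overorder R K Λ) : Prop :=
  ∀ Γ' : Subalgebra R (Λ ⊗[R] K), IsROrder R Γ' → Γ.carrier ≤ Γ' → Γ' = Γ.carrier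

/-- The canonical map `Λ → Γ`, `x ↦ x ⊗ 1`. -/
def fromBase (Γ : Overorder R K Λ) : Λ →+* Γ.carrier :=
  (Algebra.TensorProduct.includeLeft : Λ →ₐ[R] Λ ⊗[R] K).toRingHom.codRestrict Γ.carrier
    (fun x => Γ.le ⟨x, rfl⟩)

/-- A `Γ`-lattice: a left `Γ`-module which is finitely generated projective over `R`. -/
def IsLattice (Γ : Overorder R K Λ) (M : ModuleCat.{u} Γ.carrier) : Prop :=
  Module.Finite R ((ModuleCat.restrictScalars (algebraMap R Γ.carrier)).obj M) ∧
  Module.Projective R ((ModuleCat.restrictScalars (algebraMap R Γ.carrier)).obj M)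

/-- `lat Γ` as a full subcategory of the category of `Λ`-modules: the `Λ`-modules isomorphic to a
`Γ`-lattice with scalars restricted along `Λ → Γ`. -/
def lat (Γ : Overorder R K Λ) : ObjectProperty (ModuleCat.{u} Λ) :=
  fun X => ∃ M : ModuleCat.{u} Γ.carrier, Γ.IsLattice M ∧
    Nonempty (X ≅ (ModuleCat.restrictScalars Γ.fromBase).obj M)

end Overorder

end Orders

/-! A class of finitely generated projectives is right rejective once every projective `X` has a
trace: a largest submodule generated by the class that itself lies in the class. Starting from all
of `pr Λ`, the chain removes one indecomposable at a time.

Let `D` be such a class and `Y ≠ 0` in `D`. Work over a complete base with an ideal `I` (zero for an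
artin algebra, maximal for an order). Among the nonzero images in `Y/IY` of maps from `D`, take a
minimal one, and cover it by an indecomposable `P` of `D` via `s`. Both `Y` and `IY` are projective,
so `gl.dim ≤ 2` makes `ker s` projective, and its trace `Q` exists. By minimality and Fitting's
lemma, a map from `D` to `P` either splits or lands in `Q`, so `Q` is the radical of `P` in `D`
(`exists_isRadical`). If `P` is not a summand of `Q`, it can be removed: traces persist because
copies of `P` are replaced by `Q`, and the factor category has zero radical because a map not
factoring through the smaller class splits along a copy of `P`. Each removal strictly shrinks the
image of the trace of `Λ` in the artinian module `Λ/IΛ`, so the process stops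
(`exists_reachable_terminal`).

When it stops, every nonzero `Y` in `D` receives a nonzero map from some `P` that is a summand of
its own radical `Q ⊊ P`. For an artin algebra this is impossible by length, so `D = 0`. For an
order, comparing ranks gives `Q = tP` with `t` injective and topologically nilpotent; hence a
nonzero map from `D` to `P` is a power of `t` after a split epimorphism, and semisimplicity of `A`
makes `P` a summand of `Y`. So `D` behaves like lattices over a maximal order: images and kernels of
its maps stay in `D`, and an element of `A` stabilizing one full-rank left ideal in `D` stabilizes
all of `D`. The left order `Γ` of the trace `T` of `Λ` then satisfies `lat Γ = D`. It is maximal,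
since a scalar multiple of any larger order is a left ideal in `D`, and stabilizing it forces
stabilizing `T`. -/

section IdealSubmodule

/-! ### The submodule `IM` and Nakayama's lemma. -/

variable {R : Type*} [CommRing R] (I : Ideal R) (Λ : Type*) [Ring Λ] [Algebra R Λ]
  (M : Type*) [AddCommGroup M] [Module R M] [Module Λ M] [IsScalarTower R Λ M]

/-- The submodule `I M` of a `Λ`-module `M`, for an ideal `I` of the base ring. -/
def idealSubmodule : Submodule Λ M where
  __ := (I • ⊤ : Submodule R M)
  smul_mem' a x hx := by
    change x ∈ (I • ⊤ : Submodule R M) at hx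
    change a • x ∈ (I • ⊤ : Submodule R M)
    induction hx using Submodule.smul_induction_on' with
    | smul r hr n _ =>
      rw [smul_comm]
      exact Submodule.smul_mem_smul hr trivial
    | add x _ y _ hx hy =>
      rw [smul_add]
      exact add_mem hx hy

variable {I Λ M}

theorem mem_idealSubmodule {x : M} :
    x ∈ idealSubmodule I Λ M ↔ x ∈ (I • ⊤ : Submodule R M) := Iff.rfl

theorem smul_mem_idealSubmodule {r : R} (hr : r ∈ I) (x : M) : r • x ∈ idealSubmodule I Λ M := by
  rw [mem_idealSubmodule]
  exact Submodule.smul_mem_smul hr Submodule.mem_top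

theorem idealSubmodule_le {N : Submodule Λ M} (h : ∀ r ∈ I, ∀ x : M, r • x ∈ N) :
    idealSubmodule I Λ M ≤ N := by
  intro x hx
  rw [mem_idealSubmodule] at hx
  induction hx using Submodule.smul_induction_on' with
  | smul r hr n _ => exact h r hr n
  | add x _ y _ hx hy => exact add_mem hx hy

theorem map_smul_base {N : Type*} [AddCommGroup N] [Module R N] [Module Λ N] [IsScalarTower R Λ N]
    (f : M →ₗ[Λ] N) (r : R) (x : M) : f (r • x) = r • f x := by
  rw [← algebraMap_smul Λ r x, map_smul, algebraMap_smul]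

theorem map_idealSubmodule_le {N : Type*} [AddCommGroup N] [Module R N] [Module Λ N]
    [IsScalarTower R Λ N] (f : M →ₗ[Λ] N) {x : M} (hx : x ∈ idealSubmodule I Λ M) :
    f x ∈ idealSubmodule I Λ N := by
  have : idealSubmodule I Λ M ≤ (idealSubmodule I Λ N).comap f :=
    idealSubmodule_le fun r hr x => by
      rw [Submodule.mem_comap, map_smul_base (R := R)]
      exact smul_mem_idealSubmodule hr _
  exact this hx

theorem eq_top_of_sup_idealSubmodule [Module.Finite R M] (hI : I ≤ Ideal.jacobson ⊥)
    {N : Submodule Λ M} (h : ∀ x : M, ∃ y ∈ N, x - y ∈ idealSubmodule I Λ M) : N = ⊤ := by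
  have h1 : (⊤ : Submodule R M) ≤ N.restrictScalars R := by
    refine Submodule.le_of_le_smul_of_le_jacobson_bot Module.Finite.fg_top hI ?_
    intro x _
    obtain ⟨y, hy, hxy⟩ := h x
    rw [← add_sub_cancel y x]
    exact Submodule.add_mem_sup hy hxy
  exact eq_top_iff.mpr fun x _ => h1 (x := x) trivial

end IdealSubmodule

/-! ### Fitting's lemma over a complete base. -/

section Fitting

variable {R : Type v} [CommRing R] [IsNoetherianRing R] (I : Ideal R) [IsAdicComplete I R]

/-- Over a noetherian ring, completing a finite module is tensoring with the completed ring, which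
here is `R` itself. -/
theorem isAdicComplete_of_finite (M : Type v) [AddCommGroup M] [Module R M] [Module.Finite R M] :
    IsAdicComplete I M := by
  rw [← AdicCompletion.of_bijective_iff]
  have h1 := AdicCompletion.ofTensorProduct_bijective_of_finite_of_isNoetherian I M
  have h2 : Function.Bijective (AdicCompletion.of I R) :=
    AdicCompletion.of_bijective_iff.mpr inferInstance
  let e := LinearEquiv.ofBijective _ h2
  have h3 : (AdicCompletion.of I M : M → _) = (AdicCompletion.ofTensorProduct I M) ∘
      ((e.rTensor M) ∘ (TensorProduct.lid R M).symm) := by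
    ext1 x
    simp only [e, LinearEquiv.rTensor, Function.comp_apply, TensorProduct.lid_symm_apply,
      TensorProduct.congr_tmul, LinearEquiv.ofBijective_apply, LinearEquiv.refl_apply,
      AdicCompletion.ofTensorProduct_tmul]
    exact (one_smul (AdicCompletion I R) (AdicCompletion.of I M x)).symm
  rw [h3]
  exact h1.comp ((e.rTensor M).bijective.comp (TensorProduct.lid R M).symm.bijective)

/-- Lifting idempotents and Fitting's lemma in a finite commutative algebra over a complete ring
with artinian residue ring. -/
theorem exists_idempotent_of_finite [IsArtinianRing (R ⧸ I)] {B : Type v} [CommRing B] [Algebra R B]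
    [Module.Finite R B] (x : B) : ∃ (e w : B) (n : ℕ), e * e = e ∧
      e - x * w ∈ I.map (algebraMap R B) ∧ x ^ n * (1 - e) ∈ I.map (algebraMap R B) := by
  set J := I.map (algebraMap R B) with hJ
  have : IsAdicComplete I B := isAdicComplete_of_finite I B
  have : IsAdicComplete J B := (IsAdicComplete.map_algebraMap_iff _ _).mpr inferInstance
  let : Algebra (R ⧸ I) (B ⧸ J) := Ideal.Quotient.algebraQuotientOfLEComap Ideal.le_comap_map
  have : IsScalarTower R (R ⧸ I) (B ⧸ J) := IsScalarTower.of_algebraMap_eq fun _ => rfl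
  have : Module.Finite (R ⧸ I) (B ⧸ J) := Module.Finite.of_restrictScalars_finite R _ _
  have : IsArtinianRing (B ⧸ J) := IsArtinianRing.of_finite (R ⧸ I) _
  obtain ⟨n, y, hy⟩ := IsArtinian.exists_pow_succ_smul_dvd (R := B ⧸ J) (M := B ⧸ J)
    (Ideal.Quotient.mk J x) 1
  set z := Ideal.Quotient.mk J x with hz
  simp only [smul_eq_mul, mul_one] at hy
  have hk : ∀ k : ℕ, z ^ (n + k) * y ^ k = z ^ n := by
    intro k
    induction k with
    | zero => simp
    | succ k ih =>
      have : z ^ (n + (k + 1)) * y ^ (k + 1) = (z ^ n.succ * y) * (z ^ k * y ^ k) := by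
        rw [Nat.succ_eq_add_one]; ring
      rw [this, hy, ← mul_assoc, ← pow_add, ih]
  have hm : z ^ (n + 1) = z ^ (2 * (n + 1)) * y ^ (n + 1) := by
    have := hk (n + 1)
    calc z ^ (n + 1) = z * z ^ n := by ring
      _ = z * (z ^ (n + (n + 1)) * y ^ (n + 1)) := by rw [this]
      _ = _ := by ring
  obtain ⟨y', rfl⟩ := Ideal.Quotient.mk_surjective y
  -- The exponent is `n + 1` rather than `n` so that `e₀` is a multiple of `x` even when `n = 0`.
  set e₀ := (x * y') ^ (n + 1) with he₀
  have hidem : Ideal.Quotient.mk J e₀ * Ideal.Quotient.mk J e₀ = Ideal.Quotient.mk J e₀ := by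
    simp only [he₀, map_pow, map_mul, ← hz]
    set y := Ideal.Quotient.mk J y'
    calc (z * y) ^ (n + 1) * (z * y) ^ (n + 1)
        = (z ^ (2 * (n + 1)) * y ^ (n + 1)) * y ^ (n + 1) := by ring
      _ = _ := by rw [← hm]; ring
  -- Hensel's lemma for `X ^ 2 - X`. The derivative `2 * e₀ - 1` is a unit modulo `J` because it
  -- squares to `1` there.
  obtain ⟨e, he, hee⟩ := (inferInstance : HenselianRing B J).is_henselian
    (Polynomial.X ^ 2 - Polynomial.X) (by monicity!) e₀
    (by
      rw [← Ideal.Quotient.eq_zero_iff_mem]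
      simp [pow_two, hidem])
    (by
      refine IsUnit.of_mul_eq_one (Ideal.Quotient.mk J (2 * e₀ - 1)) ?_
      rw [← map_mul, ← map_one (Ideal.Quotient.mk J), ← sub_eq_zero, ← map_sub]
      simp only [Polynomial.derivative_sub, Polynomial.derivative_X_pow, Polynomial.derivative_X]
      simp only [Polynomial.eval_sub, Polynomial.eval_mul, Polynomial.eval_pow, Polynomial.eval_X,
        Polynomial.eval_one, Polynomial.eval_C]
      have : ((2 : ℕ) : B) * e₀ ^ (2 - 1) - 1 = 2 * e₀ - 1 := by simp
      rw [this]
      have : (2 * e₀ - 1) * (2 * e₀ - 1) - 1 = 4 * (e₀ * e₀ - e₀) := by ring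
      rw [this, map_mul, map_sub, map_mul, hidem, sub_self, mul_zero])
  have hmk : Ideal.Quotient.mk J e = Ideal.Quotient.mk J e₀ := Ideal.Quotient.eq.mpr hee
  refine ⟨e, y' * (x * y') ^ n, n + 1, ?_, ?_, ?_⟩
  · have : e ^ 2 - e = 0 := by simpa [Polynomial.IsRoot] using he
    linear_combination this
  · have : x * (y' * (x * y') ^ n) = e₀ := by rw [he₀]; ring
    rw [this]; exact hee
  · rw [← Ideal.Quotient.eq_zero_iff_mem, map_mul, map_sub, map_one, hmk, he₀]
    simp only [map_pow, map_mul, ← hz]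
    linear_combination hm

variable {Λ : Type*} [Ring Λ] [Algebra R Λ]
  {P : Type*} [AddCommGroup P] [Module R P] [Module Λ P] [IsScalarTower R Λ P] [Module.Finite R P]

/-- An endomorphism of a finitely generated indecomposable module is bijective or topologically
nilpotent. -/
theorem bijective_or_range_pow_le [IsArtinianRing (R ⧸ I)]
    (hP : ∀ e : Module.End Λ P, e * e = e → e = 0 ∨ e = 1) (φ : Module.End Λ P) :
    Function.Bijective φ ∨ ∃ n : ℕ, ∀ x, (φ ^ n) x ∈ idealSubmodule I Λ P := by
  -- The endomorphism ring is not commutative, so the idempotent is found in `R[X]/(p)`, where `p`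
  -- is a monic polynomial killing `φ`, and then carried over to `End P`.
  obtain ⟨p, hp, hp0⟩ := Module.End.isIntegral (R := R) |>.isIntegral (φ.restrictScalars R)
  have hp1 : Polynomial.aeval φ p = 0 := by
    have h : ∀ q : Polynomial R, (Polynomial.aeval φ q).restrictScalars R =
        Polynomial.aeval (φ.restrictScalars R : Module.End R P) q := by
      intro q
      induction q using Polynomial.induction_on' with
      | add f g hf hg => rw [map_add, map_add, ← hf, ← hg]; rfl
      | monomial n a =>
        rw [Polynomial.aeval_monomial, Polynomial.aeval_monomial]
        have h2 : ∀ n : ℕ, (φ ^ n).restrictScalars R = (φ.restrictScalars R : Module.End R P) ^ n := by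
          intro n
          induction n with
          | zero => rfl
          | succ n ih => rw [pow_succ, pow_succ, ← ih]; rfl
        rw [← h2]; rfl
    ext x
    have := congrArg (fun f => f x) (h p)
    have h0 : Polynomial.aeval (φ.restrictScalars R : Module.End R P) p = 0 := hp0
    rw [h0] at this
    exact this
  have := hp.finite_adjoinRoot
  let F : AdjoinRoot p →ₐ[R] Module.End Λ P := 
    Ideal.Quotient.liftₐ (Ideal.span {p}) (Polynomial.aeval φ) fun a ha => by
      obtain ⟨q, rfl⟩ := Ideal.mem_span_singleton'.mp ha
      rw [map_mul, hp1, mul_zero]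
  have hF : F (AdjoinRoot.root p) = φ := by
    change Polynomial.aeval φ Polynomial.X = φ
    simp
  have hFI : ∀ b ∈ I.map (algebraMap R (AdjoinRoot p)), ∀ x, F b x ∈ idealSubmodule I Λ P := by
    intro b hb
    induction hb using Submodule.span_induction with
    | mem b hb =>
      obtain ⟨r, hr, rfl⟩ := hb
      intro x
      rw [AlgHom.commutes]
      exact smul_mem_idealSubmodule hr x
    | zero => intro x; rw [map_zero]; exact zero_mem _
    | add a b _ _ ha hb => intro x; rw [map_add]; exact add_mem (ha x) (hb x)
    | smul a b _ hb =>
      intro x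
      rw [smul_eq_mul, map_mul]
      exact map_idealSubmodule_le (F a) (hb x)
  obtain ⟨e, w, n, he, h1, h2⟩ := exists_idempotent_of_finite I (AdjoinRoot.root p)
  -- If `e` acts as `0`, then `φ ^ n` maps into `IP`. If it acts as `1`, then `φ` is onto modulo
  -- `IP`, and Nakayama applies.
  rcases hP (F e) (by rw [← map_mul, he]) with h0 | h0
  · right
    refine ⟨n, fun x => ?_⟩
    have := hFI _ h2 x
    simpa [h0, hF] using this
  · left
    have : IsNoetherian Λ P := isNoetherian_of_tower R inferInstance
    apply IsNoetherian.bijective_of_surjective_endomorphism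
    rw [← LinearMap.range_eq_top]
    refine eq_top_of_sup_idealSubmodule (I := I) (R := R) (IsAdicComplete.le_jacobson_bot I)
      fun x => ⟨φ (F w x), ⟨_, rfl⟩, ?_⟩
    have := hFI _ h1 x
    simpa [h0, hF] using this

/-- If `φ ^ n` maps into `IP`, the geometric sum inverts `1 - φ` modulo `IP`. This is locality of
`End P`, which makes cancellation of `P` possible. -/
theorem bijective_or_bijective_one_sub [IsArtinianRing (R ⧸ I)]
    (hP : ∀ e : Module.End Λ P, e * e = e → e = 0 ∨ e = 1) (φ : Module.End Λ P) :
    Function.Bijective φ ∨ Function.Bijective (1 - φ : Module.End Λ P) := by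
  rcases bijective_or_range_pow_le I hP φ with h | ⟨n, h⟩
  · exact Or.inl h
  · right
    have : IsNoetherian Λ P := isNoetherian_of_tower R inferInstance
    apply IsNoetherian.bijective_of_surjective_endomorphism
    rw [← LinearMap.range_eq_top]
    refine eq_top_of_sup_idealSubmodule (I := I) (R := R) (IsAdicComplete.le_jacobson_bot I)
      fun x => ⟨(1 - φ : Module.End Λ P) ((∑ i ∈ Finset.range n, φ ^ i) x), ⟨_, rfl⟩, ?_⟩
    have : (1 - φ) * (∑ i ∈ Finset.range n, φ ^ i) = 1 - φ ^ n := mul_neg_geom_sum φ n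
    rw [← Module.End.mul_apply, this]
    simpa using h x

end Fitting

/-! ### The use of global dimension at most two. -/

section GlobalDimension

/-- The target has projective dimension at most 1. The cokernel of `s` has dimension at most 2, so
its image has dimension at most 1, and the kernel of `P` onto that image is projective. -/
theorem projective_ker_of_globalDimLE {Λ : Type u} [Ring Λ] (h : GlobalDimLE Λ 2)
    {P Y : Type u} [AddCommGroup P] [Module Λ P] [AddCommGroup Y] [Module Λ Y]
    [Module.Projective Λ P] [Module.Projective Λ Y] (Y' : Submodule Λ Y) [Module.Projective Λ Y']
    (s : P →ₗ[Λ] Y ⧸ Y') : Module.Projective Λ (LinearMap.ker s) := by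
  have key : ∀ {X Z : Type u} [AddCommGroup X] [Module Λ X] [AddCommGroup Z] [Module Λ Z]
      (f : X →ₗ[Λ] Z), Function.Surjective f →
      (ShortComplex.mk (ModuleCat.ofHom (LinearMap.ker f).subtype) (ModuleCat.ofHom f)
        (by ext x; exact x.2)).ShortExact := by
    intro X Z _ _ _ _ f hf
    refine ModuleCat.shortComplex_shortExact _ ?_ ?_ hf
    · intro x
      exact ⟨fun hx => ⟨⟨x, hx⟩, rfl⟩, by rintro ⟨y, rfl⟩; exact y.2⟩
    · exact Subtype.val_injective
  have h0 : ∀ {X : Type u} [AddCommGroup X] [Module Λ X],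
      Module.Projective Λ X ↔ HasProjectiveDimensionLT (ModuleCat.of Λ X) 1 := by
    intro X _ _
    rw [← projective_iff_hasProjectiveDimensionLT_one, ← IsProjective.iff_projective]
  have hq : HasProjectiveDimensionLT (ModuleCat.of Λ (Y ⧸ Y')) 2 := by
    have hs := key Y'.mkQ Y'.mkQ_surjective
    refine hs.hasProjectiveDimensionLT_X₃ 1 ?_ ?_
    · have : Module.Projective Λ (LinearMap.ker Y'.mkQ) := by rw [Y'.ker_mkQ]; infer_instance
      exact h0.mp this
    · have : HasProjectiveDimensionLT (ModuleCat.of Λ Y) 1 := h0.mp inferInstance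
      exact hasProjectiveDimensionLT_of_ge _ 1 2 (by lia)
  have hr : HasProjectiveDimensionLT (ModuleCat.of Λ (LinearMap.range s)) 2 := by
    have hs := key (LinearMap.range s).mkQ (Submodule.mkQ_surjective _)
    have := hs.hasProjectiveDimensionLT_X₁ 2 hq (h _)
    have h3 : HasProjectiveDimensionLT (ModuleCat.of Λ (LinearMap.ker (LinearMap.range s).mkQ)) 2 :=
      this
    rwa [Submodule.ker_mkQ] at h3
  have hs := key s.rangeRestrict s.surjective_rangeRestrict
  have := hs.hasProjectiveDimensionLT_X₁ 1 (h0.mp inferInstance) hr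
  have := h0.mpr this
  rwa [LinearMap.ker_rangeRestrict] at this

end GlobalDimension

/-! ### Classes of projectives, traces and rejective chains. -/

/-- A class of finitely generated projective `Λ`-modules closed under retracts and finite sums. -/
structure PrSub (Λ : Type u) [Ring Λ] where
  mem : ∀ (M : Type u) [AddCommGroup M] [Module Λ M], Prop
  finite : ∀ {M : Type u} [AddCommGroup M] [Module Λ M], mem M → Module.Finite Λ M
  projective : ∀ {M : Type u} [AddCommGroup M] [Module Λ M], mem M → Module.Projective Λ M
  retract : ∀ {M N : Type u} [AddCommGroup M] [Module Λ M] [AddCommGroup N] [Module Λ N],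
    mem M → ∀ (i : N →ₗ[Λ] M) (r : M →ₗ[Λ] N), r ∘ₗ i = LinearMap.id → mem N
  punit : mem PUnit
  prod : ∀ {M N : Type u} [AddCommGroup M] [Module Λ M] [AddCommGroup N] [Module Λ N],
    mem M → mem N → mem (M × N)

namespace PrSub

variable {Λ : Type u} [Ring Λ]

/-- All finitely generated projective modules. -/
def all (Λ : Type u) [Ring Λ] : PrSub Λ where
  mem M _ _ := Module.Finite Λ M ∧ Module.Projective Λ M
  finite h := h.1
  projective h := h.2
  retract h i r hir := by
    obtain ⟨_, _⟩ := h
    exact ⟨Module.Finite.of_surjective r fun x => ⟨i x, LinearMap.congr_fun hir x⟩,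
      Module.Projective.of_split i r hir⟩
  punit := ⟨inferInstance, inferInstance⟩
  prod h h' := by
    obtain ⟨_, _⟩ := h
    obtain ⟨_, _⟩ := h'
    exact ⟨inferInstance, inferInstance⟩

variable (D : PrSub Λ)

section

variable {M N : Type u} [AddCommGroup M] [Module Λ M] [AddCommGroup N] [Module Λ N]

theorem of_equiv {D : PrSub Λ} (h : D.mem M) (e : M ≃ₗ[Λ] N) : D.mem N :=
  D.retract h e.symm.toLinearMap e.toLinearMap (by ext; simp)

variable (M) in
theorem of_subsingleton [Subsingleton M] : D.mem M :=
  D.retract D.punit 0 0 (Subsingleton.elim _ _)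

/-- `f` factors through a module of the class. -/
def Factors (f : M →ₗ[Λ] N) : Prop :=
  ∃ (Z : Type u) (_ : AddCommGroup Z) (_ : Module Λ Z), D.mem Z ∧
    ∃ (g : M →ₗ[Λ] Z) (h : Z →ₗ[Λ] N), h ∘ₗ g = f

/-- `N` is the largest submodule generated by modules of the class, and belongs to the class. -/
def IsTrace (N : Submodule Λ M) : Prop :=
  D.mem N ∧ ∀ (Z : Type u) [AddCommGroup Z] [Module Λ Z], D.mem Z → ∀ f : Z →ₗ[Λ] M, ∀ z, f z ∈ N

theorem mem_ker_of_comp_eq_id {D : PrSub Λ} (h : D.mem M) (i : N →ₗ[Λ] M) (r : M →ₗ[Λ] N)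
    (hir : ∀ x, r (i x) = x) : D.mem (LinearMap.ker r) := by
  refine D.retract h (LinearMap.ker r).subtype
    (LinearMap.codRestrict _ (LinearMap.id - i ∘ₗ r) fun x => ?_) ?_
  · simp [hir]
  · ext x
    have : r x = 0 := x.2
    simp [this]

/-- A split epimorphism decomposes its source. -/
def _root_.LinearMap.equivProdKer (i : N →ₗ[Λ] M) (r : M →ₗ[Λ] N) (hir : ∀ x, r (i x) = x) :
    M ≃ₗ[Λ] N × LinearMap.ker r :=
  LinearEquiv.ofLinearMap
    (r.prod (LinearMap.codRestrict (LinearMap.ker r) (LinearMap.id - i ∘ₗ r) fun x => by simp [hir]))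
    (i.coprod (LinearMap.ker r).subtype)
    (by
      ext x
      · simp [hir]
      · simp [hir]
      · have : r (x : M) = 0 := x.2
        simp [this]
      · have : r (x : M) = 0 := x.2
        simp [this])
    (by ext x; simp)

end

/-- Every finitely generated projective module has a trace. -/
def Rejective : Prop :=
  ∀ (X : Type u) [AddCommGroup X] [Module Λ X], Module.Finite Λ X → Module.Projective Λ X →
    ∃ N : Submodule Λ X, D.IsTrace N

/-- The corresponding subcategory of `pr Λ`. -/
def toAddSubcat : AddSubcat (Pr Λ) where
  obj X := D.mem X.obj
  of_iso e h := D.retract h e.inv.hom.hom e.hom.hom.hom (by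
    have := e.inv_hom_id
    ext x
    exact congrArg (fun f => f.hom.hom x) this)
  of_isZero {X} h := by
    have : Subsingleton X.obj := by
      have h0 := (IsZero.iff_id_eq_zero X).mp h
      have h1 : ∀ x : X.obj, x = 0 := fun x =>
        congrArg (fun f : X ⟶ X => f.hom.hom x) h0
      exact ⟨fun x y => (h1 x).trans (h1 y).symm⟩
    exact D.of_subsingleton X.obj
  biprod {X Y} hX hY := D.retract (D.prod hX hY)
    ((biprod.fst : X ⊞ Y ⟶ X).hom.hom.prod (biprod.snd : X ⊞ Y ⟶ Y).hom.hom)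
    ((biprod.inl : X ⟶ X ⊞ Y).hom.hom.coprod (biprod.inr : Y ⟶ X ⊞ Y).hom.hom) (by
      have := congrArg (fun f => f.hom.hom) (biprod.total (X := X) (Y := Y))
      ext x
      exact congrArg (fun f => f x) this)
  summand {X Y} h := D.retract h (biprod.inl : X ⟶ X ⊞ Y).hom.hom
    (biprod.fst : X ⊞ Y ⟶ X).hom.hom (by
      have := congrArg (fun f => f.hom.hom) (biprod.inl_fst (X := X) (Y := Y))
      ext x
      exact congrArg (fun f => f x) this)

theorem factors_iff {X Y : Pr Λ} (f : X ⟶ Y) :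
    f ∈ D.toAddSubcat.ideal.hom X Y ↔ D.Factors f.hom.hom := by
  constructor
  · rintro ⟨Z, g, h, hZ, rfl⟩
    exact ⟨Z.obj, _, _, hZ, g.hom.hom, h.hom.hom, rfl⟩
  · rintro ⟨Z, _, _, hZ, g, h, hf⟩
    refine ⟨⟨ModuleCat.of Λ Z, D.finite hZ, D.projective hZ⟩,
      ObjectProperty.homMk (ModuleCat.ofHom g), ObjectProperty.homMk (ModuleCat.ofHom h), hZ, ?_⟩
    ext x
    exact LinearMap.congr_fun hf x

theorem Rejective.isRightRejective {D : PrSub Λ} (hD : D.Rejective) :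
    D.toAddSubcat.IsRightRejective := by
  intro X
  obtain ⟨N, hN, hN'⟩ := hD X.obj X.property.1 X.property.2
  let Y : Pr Λ := ⟨ModuleCat.of Λ N, D.finite hN, D.projective hN⟩
  let f : Y ⟶ X := ObjectProperty.homMk (ModuleCat.ofHom N.subtype)
  refine ⟨Y, f, ⟨fun {Z} g h w => ?_⟩, ⟨Y, 𝟙 Y, f, hN, Category.id_comp f⟩, fun Z g hg => ?_⟩
  · ext x
    have := congrArg (fun f => f.hom.hom x) w
    exact this
  · obtain ⟨W, _, _, hW, a, b, hab⟩ := (D.factors_iff g).mp hg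
    refine ⟨ObjectProperty.homMk (ModuleCat.ofHom
      (LinearMap.codRestrict N g.hom.hom fun z => ?_)), ?_⟩
    · rw [← hab]
      exact hN' W hW b (a z)
    · ext z
      rfl

/-- A nonzero idempotent `e` never lies in the radical: `1 - e` would have a one-sided inverse,
while `e (1 - e) = 0`. So it suffices to complete each nonzero `f` to a nonzero idempotent. -/
theorem hasZeroJacobson_factorBy {D D' : PrSub Λ}
    (H : ∀ (X Y : Type u) [AddCommGroup X] [Module Λ X] [AddCommGroup Y] [Module Λ Y],
      D.mem X → D.mem Y → ∀ f : X →ₗ[Λ] Y, D'.Factors f ∨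
        ∃ h : Y →ₗ[Λ] X, (h ∘ₗ f) ∘ₗ (h ∘ₗ f) = h ∘ₗ f ∧ ¬ D'.Factors (h ∘ₗ f)) :
    HasZeroJacobson (D.toAddSubcat.FactorBy D'.toAddSubcat) := by
  intro X Y
  rw [eq_bot_iff]
  intro f hf
  rw [AddSubgroup.mem_bot]
  let I := D'.toAddSubcat.ideal.restrict D.toAddSubcat.obj
  have hz : ∀ {X Y : D.toAddSubcat.obj.FullSubcategory} (f : X ⟶ Y),
      (Quotient.functor I.rel).map f = 0 ↔ D'.Factors f.hom.hom.hom := by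
    intro X Y f
    rw [← D'.factors_iff f.hom]
    have h0 : (0 : (Quotient.functor I.rel).obj X ⟶ (Quotient.functor I.rel).obj Y) =
      (Quotient.functor I.rel).map 0 := rfl
    rw [h0, Quotient.functor_map_eq_iff]
    change f - 0 ∈ I.hom X Y ↔ _
    rw [sub_zero]
    rfl
  obtain ⟨f, rfl⟩ := (Quotient.functor I.rel).map_surjective (X := X.as) (Y := Y.as) f
  rw [hz]
  rcases H X.as.obj.obj Y.as.obj.obj X.as.property Y.as.property f.hom.hom.hom with h | ⟨h, hh, hn⟩
  · exact h
  · exfalso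
    let h' : Y.as ⟶ X.as := ObjectProperty.homMk (ObjectProperty.homMk (ModuleCat.ofHom h))
    have h1 := hf ((Quotient.functor I.rel).map h')
    have he : (Quotient.functor I.rel).map (f ≫ h') ≫ (Quotient.functor I.rel).map (f ≫ h') =
        (Quotient.functor I.rel).map (f ≫ h') := by
      rw [← Functor.map_comp]
      congr 1
      ext x
      exact LinearMap.congr_fun hh x
    rw [← Functor.map_comp] at h1
    have h3 : (-(Quotient.functor I.rel).map (f ≫ h') : End ((Quotient.functor I.rel).obj X.as)) ∈
        Ring.jacobson (End ((Quotient.functor I.rel).obj X.as)) := Submodule.neg_mem _ h1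
    obtain ⟨t, ht⟩ := exists_comp_eq_of_mem_jacobson _ _ h3
    have h2 : (Quotient.functor I.rel).map (f ≫ h') = 0 := by
      have := congrArg (fun g => (Quotient.functor I.rel).map (f ≫ h') ≫ g) ht
      simp only [Category.comp_id] at this
      rw [← this, ← Category.assoc, Preadditive.comp_add, Category.comp_id, Preadditive.comp_neg]
      erw [he]
      rw [add_neg_cancel, zero_comp]
    exact hn ((hz _).mp h2)

/-- `D` is the end of a right rejective chain starting from `pr Λ`. -/
inductive Reachable : PrSub Λ → Prop
  | all : Reachable (PrSub.all Λ)
  | step {D D' : PrSub Λ} : Reachable D →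
      (∀ (M : Type u) [AddCommGroup M] [Module Λ M], D'.mem M → D.mem M) → D'.Rejective →
      HasZeroJacobson (D.toAddSubcat.FactorBy D'.toAddSubcat) → Reachable D'

theorem Reachable.hasRightRejectiveChain {D : PrSub Λ} (h : D.Reachable) :
    HasRightRejectiveChain (Pr Λ) D.toAddSubcat.obj := by
  induction h with
  | all => exact ⟨0, fun _ => (PrSub.all Λ).toAddSubcat, fun X => X.property, rfl, by simp⟩
  | @step D D' _ hle hrej hjac ih =>
    obtain ⟨m, F, h0, hm, hF⟩ := ih
    have hFm : F m = D.toAddSubcat := by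
      cases hF' : F m
      rw [hF'] at hm
      subst hm
      rfl
    let G : ℕ → AddSubcat (Pr Λ) := fun n => if n ≤ m then F n else D'.toAddSubcat
    have hG : ∀ n ≤ m, G n = F n := fun n hn => if_pos hn
    have hG' : G (m + 1) = D'.toAddSubcat := if_neg (by lia)
    refine ⟨m + 1, G, by rwa [hG 0 (Nat.zero_le m)], by rw [hG'], ?_⟩
    intro n hn
    rcases (Nat.lt_succ_iff.mp hn).lt_or_eq with h | rfl
    · rw [hG n h.le, hG (n + 1) h]
      exact hF n h
    · rw [hG', hG n le_rfl, hFm]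
      exact ⟨fun X => hle X.obj, hjac, hrej.isRightRejective⟩

end PrSub

/-! ### Finiteness and indecomposable summands. -/

section Preparation

theorem isArtinian_of_smul_eq_zero {R : Type*} [CommRing R] (I : Ideal R) [IsArtinianRing (R ⧸ I)]
    (Λ : Type*) [Ring Λ] [Algebra R Λ] {M : Type*} [AddCommGroup M] [Module R M] [Module Λ M]
    [IsScalarTower R Λ M] [Module.Finite R M] (h : ∀ r ∈ I, ∀ x : M, r • x = 0) :
    IsArtinian Λ M := by
  have ht : Module.IsTorsionBySet R M (I : Set R) := fun x r => h r r.2 x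
  let _ : Module (R ⧸ I) M := ht.module
  have _ : IsScalarTower R (R ⧸ I) M := ht.isScalarTower
  have _ : Module.Finite (R ⧸ I) M := Module.Finite.of_restrictScalars_finite R _ _
  have _ : IsArtinian (R ⧸ I) M := isArtinian_of_fg_of_artinian' 
  have _ : IsArtinian R M :=
    isArtinian_of_surjective_algebraMap (R := R ⧸ I) (S := R) Ideal.Quotient.mk_surjective
  exact isArtinian_of_tower R inferInstance

/-- A nonzero map from a noetherian module is nonzero on an indecomposable direct summand. -/
theorem exists_indecomposable_retract {Λ : Type*} [Ring Λ] {Z M : Type*} [AddCommGroup Z]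
    [Module Λ Z] [AddCommGroup M] [Module Λ M] [IsNoetherian Λ Z] (f : Z →ₗ[Λ] M) (hf : f ≠ 0) :
    ∃ (P : Submodule Λ Z) (r : Z →ₗ[Λ] P), (∀ x : P, r x = x) ∧ f ∘ₗ P.subtype ≠ 0 ∧
      ∀ e : Module.End Λ P, e * e = e → e = 0 ∨ e = 1 := by
  -- Among the idempotents `r` with `f ∘ r ≠ 0`, one with maximal kernel is chosen. For an
  -- idempotent of its range, either it or its complement still meets `f` nontrivially, and
  -- maximality forces that one to be `1`.
  obtain ⟨K, ⟨r, hr, hfr, rfl⟩, hmax⟩ := set_has_maximal_iff_noetherian.mpr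
    (inferInstance : IsNoetherian Λ Z)
    {K | ∃ r : Z →ₗ[Λ] Z, (∀ x, r (r x) = r x) ∧ f ∘ₗ r ≠ 0 ∧ LinearMap.ker r = K}
    ⟨_, LinearMap.id, fun _ => rfl, hf, rfl⟩
  have hfix : ∀ x ∈ LinearMap.range r, r x = x := by
    rintro _ ⟨x, rfl⟩
    exact hr x
  refine ⟨LinearMap.range r, r.rangeRestrict, fun x => Subtype.ext (hfix x x.2), ?_, ?_⟩
  · intro h
    apply hfr
    ext x
    exact LinearMap.congr_fun h ⟨r x, ⟨x, rfl⟩⟩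
  · have key : ∀ e : Module.End Λ (LinearMap.range r), e * e = e →
        f ∘ₗ ((LinearMap.range r).subtype ∘ₗ e ∘ₗ r.rangeRestrict) ≠ 0 → e = 1 := by
      intro e he hne
      have h1 : ∀ x, e (e x) = e x := fun x => LinearMap.congr_fun he x
      have h2 : ∀ y : LinearMap.range r, r.rangeRestrict y = y :=
        fun y => Subtype.ext (hfix y y.2)
      have hnlt := hmax (LinearMap.ker ((LinearMap.range r).subtype ∘ₗ e ∘ₗ r.rangeRestrict))
        ⟨_, fun x => by simp [h1, h2], hne, rfl⟩
      have hle : LinearMap.ker r ≤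
          LinearMap.ker ((LinearMap.range r).subtype ∘ₗ e ∘ₗ r.rangeRestrict) := by
        intro x hx
        have : r.rangeRestrict x = 0 := Subtype.ext hx
        simp [this]
      have heq := hle.eq_of_not_lt hnlt
      ext x
      have h3 : ((x - e x : LinearMap.range r) : Z) ∈ LinearMap.ker r := by
        rw [heq]
        simp only [LinearMap.mem_ker, LinearMap.comp_apply, h2]
        simp [h1]
      have h4 : r ((x - e x : LinearMap.range r) : Z) = 0 := h3
      rw [hfix _ (x - e x).2] at h4
      have h5 : x - e x = 0 := Subtype.ext h4
      rw [Module.End.one_apply, ← sub_eq_zero.mp h5]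
    intro e he
    by_cases h : f ∘ₗ ((LinearMap.range r).subtype ∘ₗ e ∘ₗ r.rangeRestrict) = 0
    · left
      have h1 : (1 - e) * (1 - e) = 1 - e := by
        rw [mul_sub, mul_one, sub_mul, one_mul, he, sub_self, sub_zero]
      have := key (1 - e) h1 fun h2 => hfr ?_
      · simpa using this
      · have h3 := congrArg₂ (· + ·) h h2
        ext x
        have := LinearMap.congr_fun h3 x
        simpa using this
    · exact Or.inr (key e he h)

end Preparation

/-! ### Removing an indecomposable from a class. -/

namespace PrSub

variable {Λ : Type u} [Ring Λ]

/-- Induction on the modules of a class by splitting off direct summands. -/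
theorem induction_of_split [IsNoetherianRing Λ] (D : PrSub Λ)
    {p : ∀ (M : Type u) [AddCommGroup M] [Module Λ M], Prop}
    (hp : ∀ (Z : Type u) [AddCommGroup Z] [Module Λ Z], D.mem Z → p Z ∨
      ∃ (P : Type u) (_ : AddCommGroup P) (_ : Module Λ P) (_ : Nontrivial P) (i : P →ₗ[Λ] Z)
        (r : Z →ₗ[Λ] P), (∀ x, r (i x) = x) ∧ (p (LinearMap.ker r) → p Z))
    (X : Type u) [AddCommGroup X] [Module Λ X] (hX : D.mem X) : p X := by
  have _ := D.finite hX
  have _ : IsNoetherian Λ X := isNoetherian_of_isNoetherianRing_of_finite Λ X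
  -- Noetherian induction on the kernel of a surjection from the fixed module `X`: splitting off a
  -- nontrivial `P` from the target enlarges this kernel.
  have key : ∀ K : Submodule Λ X, ∀ (Z : Type u) [AddCommGroup Z] [Module Λ Z], D.mem Z →
      ∀ f : X →ₗ[Λ] Z, Function.Surjective f → LinearMap.ker f = K → p Z := by
    intro K
    induction K using WellFoundedGT.induction with
    | ind K ih =>
      intro Z _ _ hZ f hf hK
      rcases hp Z hZ with h | ⟨P, _, _, _, i, r, hir, h⟩
      · exact h
      · apply h
        let q : Z →ₗ[Λ] LinearMap.ker r :=
          LinearMap.codRestrict _ (LinearMap.id - i ∘ₗ r) fun x => by simp [hir]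
        have hq : Function.Surjective q := fun x => ⟨x, Subtype.ext (by
          have : r (x : Z) = 0 := x.2
          simp [q, this])⟩
        refine ih (LinearMap.ker (q ∘ₗ f)) ?_ _ (mem_ker_of_comp_eq_id hZ i r hir) (q ∘ₗ f)
          (hq.comp hf) rfl
        rw [← hK]
        refine lt_of_le_of_ne (LinearMap.ker_le_ker_comp f q) fun heq => ?_
        obtain ⟨x, hx⟩ := exists_ne (0 : P)
        obtain ⟨y, hy⟩ := hf (i x)
        have h1 : y ∈ LinearMap.ker (q ∘ₗ f) := by
          rw [LinearMap.mem_ker]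
          ext
          simp [q, hy, hir]
        rw [← heq, LinearMap.mem_ker, hy] at h1
        apply hx
        rw [← hir x, h1, map_zero]
  exact key _ X hX LinearMap.id Function.surjective_id rfl

section Factors

variable (D : PrSub Λ) {M N L : Type u} [AddCommGroup M] [Module Λ M] [AddCommGroup N] [Module Λ N]
  [AddCommGroup L] [Module Λ L]

variable {D}

theorem Factors.add {f g : M →ₗ[Λ] N} (hf : D.Factors f) (hg : D.Factors g) :
    D.Factors (f + g) := by
  obtain ⟨Z, _, _, hZ, a, b, rfl⟩ := hf
  obtain ⟨W, _, _, hW, c, d, rfl⟩ := hg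
  exact ⟨Z × W, _, _, D.prod hZ hW, a.prod c, b.coprod d, by ext; simp⟩

theorem Factors.comp {f : M →ₗ[Λ] N} (hf : D.Factors f) (g : N →ₗ[Λ] L) : D.Factors (g ∘ₗ f) := by
  obtain ⟨Z, _, _, hZ, a, b, rfl⟩ := hf
  exact ⟨Z, _, _, hZ, a, g ∘ₗ b, rfl⟩

end Factors

variable (D : PrSub Λ) (P : Type u) [AddCommGroup P] [Module Λ P]

/-- The modules of a class which do not have the indecomposable module `P` as a direct summand. -/
def remove [Nontrivial P] (hP : ∀ φ : Module.End Λ P, Function.Bijective φ ∨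
    Function.Bijective (1 - φ : Module.End Λ P)) : PrSub Λ where
  mem M _ _ := D.mem M ∧ ∀ (i : P →ₗ[Λ] M) (r : M →ₗ[Λ] P), r ∘ₗ i ≠ LinearMap.id
  finite h := D.finite h.1
  projective h := D.projective h.1
  retract h i r hir := ⟨D.retract h.1 i r hir, fun j s hjs => h.2 (i ∘ₗ j) (s ∘ₗ r) (by
    rw [LinearMap.comp_assoc, ← LinearMap.comp_assoc _ _ r, hir, LinearMap.id_comp, hjs])⟩
  punit := ⟨D.punit, fun i r h => by
    obtain ⟨x, hx⟩ := exists_ne (0 : P)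
    apply hx
    rw [← LinearMap.id_apply (R := Λ) x, ← h, Subsingleton.elim i 0]
    simp⟩
  prod {M N} _ _ _ _ h h' := ⟨D.prod h.1 h'.1, fun i r hir => by
    have key : ∀ {L : Type u} [AddCommGroup L] [Module Λ L],
        (∀ (i : P →ₗ[Λ] L) (r : L →ₗ[Λ] P), r ∘ₗ i ≠ LinearMap.id) →
        ∀ (i : P →ₗ[Λ] L) (r : L →ₗ[Λ] P), ¬ Function.Bijective (r ∘ₗ i) := by
      intro L _ _ hL i r hb
      refine hL i ((LinearEquiv.ofBijective _ hb).symm.toLinearMap ∘ₗ r) ?_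
      ext x
      exact (LinearEquiv.ofBijective _ hb).symm_apply_apply x
    -- The identity of `P` is the sum of its parts through `M` and through `N`. Locality of `End P`
    -- makes one of them invertible, so `P` would be a summand of `M` or of `N`.
    rcases hP ((r ∘ₗ LinearMap.inl Λ M N) ∘ₗ (LinearMap.fst Λ M N ∘ₗ i)) with h1 | h1
    · exact key h.2 _ _ h1
    · refine key h'.2 (LinearMap.snd Λ M N ∘ₗ i) (r ∘ₗ LinearMap.inr Λ M N) ?_
      convert h1 using 2
      rw [← sub_eq_zero]
      ext x
      have h2 := LinearMap.congr_fun hir x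
      have h3 : r ((i x).1, 0) + r (0, (i x).2) = x := by
        rw [← map_add]; simpa using h2
      have h4 : r (0, (i x).2) = x - r ((i x).1, 0) := eq_sub_of_add_eq' h3
      simp [h4]⟩

variable {D P}

/-- The data of a class, an indecomposable module `P` of the class and the radical `Q` of `P` in
the class. -/
structure IsRadical (D : PrSub Λ) (Q : Submodule Λ P) : Prop where
  mem : D.mem P
  mem_radical : D.mem Q
  indecomposable : ∀ e : Module.End Λ P, e * e = e → e = 0 ∨ e = 1
  ne_top : Q ≠ ⊤
  split_or_mem : ∀ (Z : Type u) [AddCommGroup Z] [Module Λ Z], D.mem Z → ∀ f : Z →ₗ[Λ] P,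
    (∃ g : P →ₗ[Λ] Z, f ∘ₗ g = LinearMap.id) ∨ ∀ z, f z ∈ Q

theorem IsRadical.nontrivial {Q : Submodule Λ P} (h : D.IsRadical Q) : Nontrivial P := by
  by_contra hn
  rw [not_nontrivial_iff_subsingleton] at hn
  exact h.ne_top (Subsingleton.elim _ _)

section Remove

variable [IsNoetherianRing Λ] [Nontrivial P] (hP : ∀ φ : Module.End Λ P, Function.Bijective φ ∨
    Function.Bijective (1 - φ : Module.End Λ P)) {Q : Submodule Λ P} (hQ : D.IsRadical Q)
    (hPQ : ∀ (i : P →ₗ[Λ] Q) (r : Q →ₗ[Λ] P), r ∘ₗ i ≠ LinearMap.id)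

include hQ hPQ

/-- In a decomposition of `Z` into copies of `P` and a rest without `P`, the trace arises by
replacing each copy of `P` by `Q`. The set `S` records scalars that push `Z` into the trace, so that
the trace can later be kept of full rank. -/
theorem exists_isTrace_remove {S : Set Λ} (hS : ∀ a ∈ S, ∀ x : P, a • x ∈ Q)
    (Z : Type u) [AddCommGroup Z] [Module Λ Z]
    (hZ : D.mem Z) :
    ∃ N : Submodule Λ Z, (D.remove P hP).IsTrace N ∧ ∀ a ∈ S, ∀ x : Z, a • x ∈ N := by
  refine D.induction_of_split (p := fun Z _ _ => ∃ N : Submodule Λ Z, (D.remove P hP).IsTrace N ∧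
    ∀ a ∈ S, ∀ x : Z, a • x ∈ N) (fun Z _ _ hZ => ?_) Z hZ
  by_cases hZ' : (D.remove P hP).mem Z
  · refine Or.inl ⟨⊤, ⟨?_, fun _ _ _ _ _ _ => trivial⟩, fun _ _ _ => trivial⟩
    exact of_equiv hZ' Submodule.topEquiv.symm
  · have : ∃ (i : P →ₗ[Λ] Z) (r : Z →ₗ[Λ] P), r ∘ₗ i = LinearMap.id := by
      by_contra h
      push Not at h
      exact hZ' ⟨hZ, h⟩
    obtain ⟨i, r, hir⟩ := this
    have hir' : ∀ x, r (i x) = x := LinearMap.congr_fun hir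
    refine Or.inr ⟨P, _, _, inferInstance, i, r, hir', ?_⟩
    rintro ⟨N, ⟨hN, hN'⟩, hNS⟩
    let q : Z →ₗ[Λ] LinearMap.ker r :=
      LinearMap.codRestrict _ (LinearMap.id - i ∘ₗ r) fun x => by simp [hir']
    have hqi : ∀ x, q (i x) = 0 := fun x => Subtype.ext (by simp [q, hir'])
    have hq : ∀ x : LinearMap.ker r, q x = x := fun x => Subtype.ext (by
      have : r (x : Z) = 0 := x.2
      simp [q, this])
    have hdec : ∀ z, i (r z) + q z = z := fun z => by simp [q]
    let T : Submodule Λ Z := Q.comap r ⊓ N.comap q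
    refine ⟨T, ⟨?_, ?_⟩, ?_⟩
    · have hQN : (D.remove P hP).mem (Q × N) := (D.remove P hP).prod ⟨hQ.mem_radical, hPQ⟩ hN
      refine (D.remove P hP).retract hQN
        (((r.restrict (p := T) (q := Q)) fun x hx => hx.1).prod
          ((q.restrict (p := T) (q := N)) fun x hx => hx.2))
        (LinearMap.codRestrict T ((i ∘ₗ Q.subtype).coprod
          ((LinearMap.ker r).subtype ∘ₗ N.subtype)) ?_) ?_
      · rintro ⟨⟨a, ha⟩, ⟨b, hb⟩⟩
        have hrb : r (b : Z) = 0 := b.2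
        refine ⟨?_, ?_⟩
        · simpa [hir', hrb] using ha
        · simpa [hqi, hq] using hb
      · ext x
        exact hdec x
    · intro W _ _ hW w x
      refine ⟨?_, hN' W hW (q ∘ₗ w) x⟩
      -- A module without the summand `P` admits no split epimorphism onto `P`, so its maps to `P`
      -- land in `Q`.
      rcases hQ.split_or_mem W hW.1 (r ∘ₗ w) with ⟨g, hg⟩ | h
      · exact absurd hg (hW.2 g (r ∘ₗ w))
      · exact h x
    · intro a ha x
      refine ⟨?_, ?_⟩
      · change r (a • x) ∈ Q
        rw [map_smul]
        exact hS a ha _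
      · change q (a • x) ∈ N
        rw [map_smul]
        exact hNS a ha _

/-- Maps from the smaller class first land in the trace `N` of the larger one, so its trace may be
computed inside `N`. -/
theorem exists_isTrace_remove_of_isTrace {S : Set Λ} (hS : ∀ a ∈ S, ∀ x : P, a • x ∈ Q)
    {X : Type u} [AddCommGroup X] [Module Λ X] {N : Submodule Λ X} (hN : D.IsTrace N) :
    ∃ N' : Submodule Λ X, (D.remove P hP).IsTrace N' ∧ ∀ a ∈ S, ∀ x ∈ N, a • x ∈ N' := by
  obtain ⟨N₂, ⟨h1, h2⟩, h3⟩ := exists_isTrace_remove hP hQ hPQ hS N hN.1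
  refine ⟨N₂.map N.subtype, ⟨?_, ?_⟩, ?_⟩
  · exact of_equiv h1 (Submodule.equivMapOfInjective _ N.injective_subtype N₂)
  · intro Z _ _ hZ f z
    exact ⟨_, h2 Z hZ (LinearMap.codRestrict N f (hN.2 Z hZ.1 f)) z, rfl⟩
  · intro a ha x hx
    exact ⟨_, h3 a ha ⟨x, hx⟩, rfl⟩

theorem rejective_remove (hD : D.Rejective) : (D.remove P hP).Rejective := by
  intro X _ _ h1 h2
  obtain ⟨N, hN⟩ := hD X h1 h2
  obtain ⟨N', hN', -⟩ := exists_isTrace_remove_of_isTrace hP hQ hPQ (S := ∅) (by simp) hN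
  exact ⟨N', hN'⟩

/-- Copies of `P` are split off the target. A component to `P` either is a split epimorphism, which
yields an idempotent that recovers the identity of `P`, or lands in `Q`, which belongs to the
smaller class. -/
theorem hasZeroJacobson_remove :
    HasZeroJacobson (D.toAddSubcat.FactorBy (D.remove P hP).toAddSubcat) := by
  apply hasZeroJacobson_factorBy
  have key : ∀ (Y : Type u) [AddCommGroup Y] [Module Λ Y], D.mem Y →
      ∀ (X : Type u) [AddCommGroup X] [Module Λ X], D.mem X → ∀ f : X →ₗ[Λ] Y,
      (D.remove P hP).Factors f ∨ ∃ (p : Y →ₗ[Λ] P) (g : P →ₗ[Λ] X), ∀ x, p (f (g x)) = x := by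
    intro Y _ _ hY
    refine D.induction_of_split (p := fun Y _ _ => ∀ (X : Type u) [AddCommGroup X] [Module Λ X],
      D.mem X → ∀ f : X →ₗ[Λ] Y, (D.remove P hP).Factors f ∨
        ∃ (p : Y →ₗ[Λ] P) (g : P →ₗ[Λ] X), ∀ x, p (f (g x)) = x) (fun Z _ _ hZ => ?_) Y hY
    by_cases hZ' : (D.remove P hP).mem Z
    · exact Or.inl fun X _ _ _ f => Or.inl ⟨Z, _, _, hZ', f, LinearMap.id, rfl⟩
    · have : ∃ (i : P →ₗ[Λ] Z) (r : Z →ₗ[Λ] P), r ∘ₗ i = LinearMap.id := by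
        by_contra h
        push Not at h
        exact hZ' ⟨hZ, h⟩
      obtain ⟨i, r, hir⟩ := this
      have hir' : ∀ x, r (i x) = x := LinearMap.congr_fun hir
      refine Or.inr ⟨P, _, _, inferInstance, i, r, hir', ?_⟩
      intro ih X _ _ hX f
      let q : Z →ₗ[Λ] LinearMap.ker r :=
        LinearMap.codRestrict _ (LinearMap.id - i ∘ₗ r) fun x => by simp [hir']
      rcases hQ.split_or_mem X hX (r ∘ₗ f) with ⟨g, hg⟩ | h
      · exact Or.inr ⟨r, g, LinearMap.congr_fun hg⟩
      · rcases ih X hX (q ∘ₗ f) with h' | ⟨p, g, h'⟩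
        · left
          have h1 : (D.remove P hP).Factors (r ∘ₗ f) :=
            ⟨Q, _, _, ⟨hQ.mem_radical, hPQ⟩, LinearMap.codRestrict Q (r ∘ₗ f) h, Q.subtype, rfl⟩
          convert (h1.comp i).add (h'.comp (LinearMap.ker r).subtype)
          ext x
          simp [q]
        · exact Or.inr ⟨p ∘ₗ q, g, h'⟩
  intro X Y _ _ _ _ hX hY f
  rcases key Y hY X hX f with h | ⟨p, g, h⟩
  · exact Or.inl h
  · refine Or.inr ⟨g ∘ₗ p, ?_, ?_⟩
    · ext x
      simp [h]
    · rintro ⟨Z, _, _, hZ, a, b, hab⟩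
      refine hZ.2 (a ∘ₗ g) (p ∘ₗ f ∘ₗ b) ?_
      ext x
      have := LinearMap.congr_fun hab (g x)
      simp only [LinearMap.comp_apply] at this
      simp [this, h]

omit [IsNoetherianRing Λ] hPQ in
/-- Removing `P` makes the trace in the regular module strictly smaller. -/
theorem not_le_trace_remove {T T' J : Submodule Λ Λ} (hT : D.IsTrace T)
    (hT' : (D.remove P hP).IsTrace T') (hJ : ∀ a ∈ J, ∀ x : P, a • x ∈ Q) : ¬ T ≤ T' ⊔ J := by
  intro hle
  apply hQ.ne_top
  rw [eq_top_iff]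
  intro x _
  have _ := D.projective hQ.mem
  -- A dual basis writes `x` as a sum of `s x y • y` with coefficients in `T`. If `T ≤ T' ⊔ J`, the
  -- `T'` part of a coefficient sends `y` into `Q`, since `T'` cannot map onto `P` by a split
  -- epimorphism, and so does the `J` part. Then `Q = P`.
  obtain ⟨s, hs⟩ := Module.projective_def.mp (D.projective hQ.mem)
  rw [← hs x, Finsupp.linearCombination_apply]
  refine Submodule.sum_mem _ fun y _ => ?_
  have h1 : s x y ∈ T := hT.2 P hQ.mem (Finsupp.lapply y ∘ₗ s) x
  obtain ⟨a, ha, b, hb, hab⟩ := Submodule.mem_sup.mp (hle h1)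
  change (s x y) • y ∈ Q
  rw [← hab, add_smul]
  refine add_mem ?_ (hJ b hb y)
  rcases hQ.split_or_mem T' hT'.1.1 (LinearMap.toSpanSingleton Λ P y ∘ₗ T'.subtype) with ⟨g, hg⟩ | h
  · exact absurd hg (hT'.1.2 g _)
  · exact h ⟨a, ha⟩

end Remove

end PrSub

/-! ### Existence of radicals and termination of the removals. -/

namespace PrSub

variable {R : Type u₁} [CommRing R] [IsNoetherianRing R] (I : Ideal R) [IsAdicComplete I R]
  [IsArtinianRing (R ⧸ I)] {Λ : Type u} [Ring Λ] [Algebra R Λ] [Module.Finite R Λ]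

/-- In a rejective class over an algebra of global dimension at most two, every nonzero module
admits a nonzero map from an indecomposable module whose radical belongs to the class. -/
theorem exists_isRadical (hgl : GlobalDimLE Λ 2)
    (hI : ∀ (Y : Type u) [AddCommGroup Y] [Module R Y] [Module Λ Y] [IsScalarTower R Λ Y],
      Module.Finite Λ Y → Module.Projective Λ Y → Module.Projective Λ (idealSubmodule I Λ Y))
    {D : PrSub Λ} (hD : D.Rejective) {Y : Type u} [AddCommGroup Y] [Module Λ Y] (hY : D.mem Y)
    [Nontrivial Y] :
    ∃ (P : Type u) (_ : AddCommGroup P) (_ : Module Λ P) (Q : Submodule Λ P) (f : P →ₗ[Λ] Y),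
      f ≠ 0 ∧ D.IsRadical Q ∧ ∀ r ∈ I, ∀ x : P, algebraMap R Λ r • x ∈ Q := by
  have hIj := IsAdicComplete.le_jacobson_bot I
  have _ : IsNoetherianRing Λ := isNoetherian_of_tower R inferInstance
  let _ : Module R Y := Module.compHom Y (algebraMap R Λ)
  have _ : IsScalarTower R Λ Y := IsScalarTower.of_algebraMap_smul fun _ _ => rfl
  have _ := D.finite hY
  have _ := D.projective hY
  have _ := hI Y inferInstance inferInstance
  have _ : Module.Finite R Y := Module.Finite.trans Λ Y
  set J := idealSubmodule I Λ Y with hJ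
  have hM0 : ∀ r ∈ I, ∀ x : Y ⧸ J, r • x = 0 := by
    intro r hr x
    obtain ⟨y, rfl⟩ := J.mkQ_surjective x
    rw [← map_smul_base]
    exact (Submodule.Quotient.mk_eq_zero _).mpr (smul_mem_idealSubmodule hr y)
  have _ : Module.Finite R (Y ⧸ J) :=
    Module.Finite.of_surjective (J.mkQ.restrictScalars R) J.mkQ_surjective
  have _ : IsArtinian Λ (Y ⧸ J) := isArtinian_of_smul_eq_zero I Λ hM0
  -- `N` need not be simple: it is minimal only among nonzero images of modules of the class. This
  -- makes every nonzero map from the class into `N` surjective.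
  obtain ⟨N, ⟨hN0, Z, _, _, hZ, f, hf⟩, hmin⟩ := IsArtinian.set_has_minimal
    {N : Submodule Λ (Y ⧸ J) | N ≠ ⊥ ∧ ∃ (Z : Type u) (_ : AddCommGroup Z) (_ : Module Λ Z)
      (_ : D.mem Z) (f : Z →ₗ[Λ] Y ⧸ J), LinearMap.range f = N} (by
    refine ⟨_, ?_, Y, _, _, hY, J.mkQ, rfl⟩
    rw [Submodule.range_mkQ]
    intro h
    have hJt : J = ⊤ := eq_top_of_sup_idealSubmodule (I := I) (R := R) hIj fun x => by
      refine ⟨0, zero_mem _, ?_⟩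
      rw [sub_zero, ← Submodule.Quotient.mk_eq_zero, ← Submodule.mem_bot Λ, ← h]
      trivial
    have h0 : (⊥ : Submodule Λ Y) = ⊤ := eq_top_of_sup_idealSubmodule (I := I) (R := R) hIj
      fun x => ⟨0, zero_mem _, by rw [← hJ, hJt]; trivial⟩
    exact bot_ne_top h0)
  have _ := D.finite hZ
  have _ : IsNoetherian Λ Z := isNoetherian_of_isNoetherianRing_of_finite Λ Z
  have hf0 : f ≠ 0 := by
    rintro rfl
    exact hN0 (by rw [← hf, LinearMap.range_zero])
  obtain ⟨P, r, hr, hs0, hind⟩ := exists_indecomposable_retract f hf0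
  have hP : D.mem P := D.retract hZ P.subtype r (by ext x; simp [hr])
  set s := f ∘ₗ P.subtype with hs
  have hrange : ∀ (W : Type u) [AddCommGroup W] [Module Λ W], D.mem W → ∀ g : W →ₗ[Λ] Y ⧸ J,
      g ≠ 0 → LinearMap.range g ≤ N → LinearMap.range g = N := by
    intro W _ _ hW g hg hle
    refine hle.eq_of_not_lt (hmin _ ⟨?_, W, _, _, hW, g, rfl⟩)
    rwa [ne_eq, LinearMap.range_eq_bot]
  have hsN : LinearMap.range s = N :=
    hrange P hP s hs0 (by rw [hs, ← hf]; exact LinearMap.range_comp_le_range _ _)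
  have _ := D.projective hP
  have _ := D.finite hP
  have _ : Module.Projective Λ (LinearMap.ker s) := projective_ker_of_globalDimLE hgl J s
  have _ : IsNoetherian Λ P := isNoetherian_of_isNoetherianRing_of_finite Λ P
  obtain ⟨T, hT, hT'⟩ := hD (LinearMap.ker s) inferInstance inferInstance
  let _ : Module R P := Module.compHom P (algebraMap R Λ)
  have _ : IsScalarTower R Λ P := IsScalarTower.of_algebraMap_smul fun _ _ => rfl
  have _ : Module.Finite R P := Module.Finite.trans Λ P
  obtain ⟨l, hl⟩ := Module.projective_lifting_property J.mkQ s J.mkQ_surjective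
  refine ⟨P, _, _, T.map (LinearMap.ker s).subtype, l, ?_, ⟨hP, ?_, hind, ?_, ?_⟩, ?_⟩
  · rintro rfl
    exact hs0 (by rw [← hl, LinearMap.comp_zero])
  · exact of_equiv hT (Submodule.equivMapOfInjective _ (LinearMap.ker s).injective_subtype T)
  · intro h
    apply hs0
    ext x
    obtain ⟨y, -, hy⟩ : x ∈ T.map (LinearMap.ker s).subtype := by rw [h]; trivial
    rw [← hy]
    exact y.2
  · intro W _ _ hW h
    by_cases hsh : s ∘ₗ h = 0
    · right
      intro z
      exact ⟨_, hT' W hW (LinearMap.codRestrict _ h (LinearMap.congr_fun hsh)) z, rfl⟩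
    · left
      have h1 : LinearMap.range (s ∘ₗ h) = LinearMap.range s := by
        rw [hsN]
        refine hrange W hW _ hsh ?_
        rw [← hsN]
        exact LinearMap.range_comp_le_range _ _
      -- Since `s ∘ h` has the same image as `s`, projectivity gives `g` with `s ∘ h ∘ g = s`. If `h
      -- ∘ g` were topologically nilpotent, iterating would put the image of `s` in `I(Y/IY) = 0`;
      -- hence `h ∘ g` is bijective and `h` splits.
      obtain ⟨g, hg⟩ := Module.projective_lifting_property (s ∘ₗ h).rangeRestrict
        (LinearMap.codRestrict (LinearMap.range (s ∘ₗ h)) s fun x => by rw [h1]; exact ⟨x, rfl⟩)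
        (s ∘ₗ h).surjective_rangeRestrict
      have hg' : ∀ x, s (h (g x)) = s x := fun x =>
        congrArg Subtype.val (LinearMap.congr_fun hg x)
      rcases bijective_or_range_pow_le I hind (h ∘ₗ g) with hb | ⟨n, hn⟩
      · refine ⟨g ∘ₗ (LinearEquiv.ofBijective _ hb).symm.toLinearMap, ?_⟩
        ext x : 1
        exact (LinearEquiv.ofBijective _ hb).apply_symm_apply x
      · exfalso
        apply hs0
        ext x
        have h2 : ∀ n : ℕ, s (((h ∘ₗ g : Module.End Λ P) ^ n) x) = s x := by
          intro n
          induction n with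
          | zero => rfl
          | succ n ih =>
            rw [pow_succ', Module.End.mul_apply, ← ih]
            exact hg' _
        rw [← h2 n]
        have h3 := map_idealSubmodule_le s (hn x)
        have h4 : idealSubmodule I Λ (Y ⧸ J) ≤ ⊥ :=
          idealSubmodule_le fun r hr x => by rw [hM0 r hr x]; exact zero_mem _
        exact h4 h3
  · intro a ha x
    let φ : P →ₗ[Λ] LinearMap.ker s := LinearMap.codRestrict _
      { toFun := fun x => a • x
        map_add' := smul_add a
        map_smul' := fun b x => smul_comm a b x } fun x => by
          change s (a • x) = 0
          rw [map_smul_base, hM0 a ha]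
    exact ⟨_, hT' P hP φ x, rfl⟩

/-- There is a right rejective chain ending in a class all of whose nonzero modules receive nonzero
maps from an indecomposable module that is a direct summand of its radical. -/
theorem exists_reachable_terminal (hgl : GlobalDimLE Λ 2)
    (hI : ∀ (Y : Type u) [AddCommGroup Y] [Module R Y] [Module Λ Y] [IsScalarTower R Λ Y],
      Module.Finite Λ Y → Module.Projective Λ Y → Module.Projective Λ (idealSubmodule I Λ Y)) :
    ∃ D : PrSub Λ, D.Reachable ∧
      (∃ (n : ℕ) (T : Submodule Λ Λ), D.IsTrace T ∧ ∀ r ∈ I ^ n, algebraMap R Λ r ∈ T) ∧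
      ∀ (Y : Type u) [AddCommGroup Y] [Module Λ Y], D.mem Y → Nontrivial Y →
        ∃ (P : Type u) (_ : AddCommGroup P) (_ : Module Λ P) (Q : Submodule Λ P) (f : P →ₗ[Λ] Y),
          f ≠ 0 ∧ D.IsRadical Q ∧ ∃ (i : P →ₗ[Λ] Q) (r : Q →ₗ[Λ] P), r ∘ₗ i = LinearMap.id := by
  have _ : IsNoetherianRing Λ := isNoetherian_of_tower R inferInstance
  set J := idealSubmodule I Λ Λ with hJ
  have _ : Module.Finite R (Λ ⧸ J) :=
    Module.Finite.of_surjective (J.mkQ.restrictScalars R) J.mkQ_surjective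
  have _ : IsArtinian Λ (Λ ⧸ J) := by
    refine isArtinian_of_smul_eq_zero I Λ fun r hr x => ?_
    obtain ⟨y, rfl⟩ := J.mkQ_surjective x
    rw [← map_smul_base]
    exact (Submodule.Quotient.mk_eq_zero _).mpr (smul_mem_idealSubmodule hr y)
  -- The terminating measure is the image of the trace of `Λ` in `Λ/IΛ`. The condition on `I ^ n`
  -- loses one power of `I` per removal and later guarantees that the trace of an order has full
  -- rank.
  obtain ⟨_, ⟨D, T, n, hD, hrej, hT, hn, rfl⟩, hmin⟩ := IsArtinian.set_has_minimal
    {K : Submodule Λ (Λ ⧸ J) | ∃ (D : PrSub Λ) (T : Submodule Λ Λ) (n : ℕ), D.Reachable ∧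
      D.Rejective ∧ D.IsTrace T ∧ (∀ r ∈ I ^ n, algebraMap R Λ r ∈ T) ∧ T.map J.mkQ = K} (by
    refine ⟨_, all Λ, ⊤, 0, Reachable.all, ?_, ?_, fun _ _ => trivial, rfl⟩
    · exact fun X _ _ h1 h2 => ⟨⊤, of_equiv (D := all Λ) ⟨h1, h2⟩ Submodule.topEquiv.symm,
        fun _ _ _ _ _ _ => trivial⟩
    · exact ⟨of_equiv (D := all Λ) (M := Λ) ⟨inferInstance, inferInstance⟩
        Submodule.topEquiv.symm, fun _ _ _ _ _ _ => trivial⟩)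
  refine ⟨D, hD, ⟨n, T, hT, hn⟩, fun Y _ _ hY _ => ?_⟩
  obtain ⟨P, _, _, Q, f, hf, hQ, hIQ⟩ := exists_isRadical I hgl hI hrej hY
  refine ⟨P, _, _, Q, f, hf, hQ, ?_⟩
  by_contra hne
  push Not at hne
  have _ := hQ.nontrivial
  let _ : Module R P := Module.compHom P (algebraMap R Λ)
  have _ : IsScalarTower R Λ P := IsScalarTower.of_algebraMap_smul fun _ _ => rfl
  have _ := D.finite hQ.mem
  have _ : Module.Finite R P := Module.Finite.trans Λ P
  have hP := bijective_or_bijective_one_sub I hQ.indecomposable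
  have hIQ' : ∀ a ∈ J, ∀ x : P, a • x ∈ Q := by
    intro a ha x
    have : J ≤ Q.comap (LinearMap.toSpanSingleton Λ P x) := idealSubmodule_le fun r hr b => by
      rw [Submodule.mem_comap, LinearMap.toSpanSingleton_apply, Algebra.smul_def, mul_smul]
      exact hIQ r hr _
    exact this ha
  obtain ⟨T', hT', hTT'⟩ := exists_isTrace_remove_of_isTrace hP hQ hne (S := (algebraMap R Λ) '' I)
    (by rintro _ ⟨r, hr, rfl⟩ x; exact hIQ r hr x) hT
  refine hmin (T'.map J.mkQ) ⟨D.remove P hP, T', n + 1,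
    hD.step (fun M _ _ h => h.1) (rejective_remove hP hQ hne hrej)
      (hasZeroJacobson_remove hP hQ hne), rejective_remove hP hQ hne hrej, hT', ?_, rfl⟩ ?_
  · intro r hr
    rw [pow_succ'] at hr
    induction hr using Submodule.mul_induction_on' with
    | mem_mul_mem a ha b hb =>
      rw [map_mul]
      exact hTT' _ ⟨a, ha, rfl⟩ _ (hn b hb)
    | add a _ b _ ha hb =>
      rw [map_add]
      exact add_mem ha hb
  · have hle : T' ≤ T := fun x hx => hT.2 T' hT'.1.1 T'.subtype ⟨x, hx⟩
    refine lt_of_le_of_ne (Submodule.map_mono hle) fun heq => ?_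
    refine not_le_trace_remove hP hQ hT hT' hIQ' ?_
    intro x hx
    have h1 : J.mkQ x ∈ T'.map J.mkQ := by rw [heq]; exact ⟨x, hx, rfl⟩
    obtain ⟨y, hy, hxy⟩ := h1
    have h2 : x - y ∈ J := by
      rw [← Submodule.Quotient.mk_eq_zero, Submodule.Quotient.mk_sub, sub_eq_zero]
      exact hxy.symm
    rw [← add_sub_cancel y x]
    exact Submodule.add_mem_sup hy h2

end PrSub

/-! ### The artin algebra case. -/

/-- The class of finitely generated projective modules over an artin algebra of global dimension
at most two has a right rejective chain to zero. -/
theorem hasRightRejectiveChain_of_isArtinianRing (k : Type u₁) [CommRing k] [IsArtinianRing k]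
    (Λ : Type u) [Ring Λ] [Algebra k Λ] [Module.Finite k Λ] (hgl : GlobalDimLE Λ 2) :
    HasRightRejectiveChain (Pr Λ) (fun X => IsZero X) := by
  have _ : IsArtinianRing (k ⧸ (⊥ : Ideal k)) := inferInstance
  obtain ⟨D, hD, -, hterm⟩ := PrSub.exists_reachable_terminal (⊥ : Ideal k) hgl (by
    intro Y _ _ _ _ _ _
    have h : idealSubmodule (⊥ : Ideal k) Λ Y = ⊥ := eq_bot_iff.mpr <|
      idealSubmodule_le fun r hr x => by
        rw [Ideal.mem_bot.mp hr, zero_smul]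
        exact zero_mem _
    rw [h]
    infer_instance)
  have key : ∀ (Y : Type u) [AddCommGroup Y] [Module Λ Y], D.mem Y → Subsingleton Y := by
    intro Y _ _ hY
    by_contra hn
    rw [not_subsingleton_iff_nontrivial] at hn
    obtain ⟨P, _, _, Q, -, -, hQ, i, r, hir⟩ := hterm Y hY hn
    have _ := D.finite hQ.mem
    have _ : IsArtinianRing Λ := isArtinian_of_tower k inferInstance
    have _ : IsArtinian Λ P := isArtinian_of_fg_of_artinian'
    -- `P` embeds into its proper submodule `Q`, contradicting the descending chain condition on
    -- `P`.
    have hb := IsArtinian.bijective_of_injective_endomorphism (Q.subtype ∘ₗ i)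
      (Q.injective_subtype.comp (Function.LeftInverse.injective (LinearMap.congr_fun hir)))
    apply hQ.ne_top
    rw [eq_top_iff]
    intro x _
    obtain ⟨y, rfl⟩ := hb.2 x
    exact (i y).2
  have h := hD.hasRightRejectiveChain
  convert h using 1
  ext X
  constructor
  · exact fun h => D.toAddSubcat.of_isZero h
  · intro hX
    have := key X.obj hX
    rw [IsZero.iff_id_eq_zero]
    ext x
    exact Subsingleton.elim _ _

/-! ### Splitting of lattices up to a scalar. -/

section Semisimple

variable {R : Type u₁} [CommRing R] [IsDomain R] [IsPrincipalIdealRing R]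
  {K : Type u₂} [Field K] [Algebra R K] [IsFractionRing R K]
  {Λ : Type u} [Ring Λ] [Algebra R Λ]

omit [IsPrincipalIdealRing R] in
theorem exists_smul_eq_tmul_one {M : Type*} [AddCommGroup M] [Module R M] (v : M ⊗[R] K) :
    ∃ (r : R) (m : M), r ≠ 0 ∧ r • v = m ⊗ₜ[R] (1 : K) := by
  induction v using TensorProduct.induction_on with
  | zero => exact ⟨1, 0, one_ne_zero, by simp⟩
  | tmul m x =>
    obtain ⟨a, b, hb, rfl⟩ := IsFractionRing.div_surjective (A := R) x
    have hb0 := nonZeroDivisors.ne_zero hb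
    refine ⟨b, a • m, hb0, ?_⟩
    have hb1 : algebraMap R K b ≠ 0 := by
      rwa [ne_eq, FaithfulSMul.algebraMap_eq_zero_iff]
    rw [← TensorProduct.tmul_smul, TensorProduct.smul_tmul, Algebra.smul_def, Algebra.smul_def,
      mul_div_cancel₀ _ hb1, mul_one]
  | add v w hv hw =>
    obtain ⟨r, m, hr, h1⟩ := hv
    obtain ⟨s, n, hs, h2⟩ := hw
    refine ⟨r * s, s • m + r • n, mul_ne_zero hr hs, ?_⟩
    rw [smul_add, TensorProduct.add_tmul, mul_smul r s w, mul_comm r s, mul_smul, h1, h2,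
      TensorProduct.smul_tmul', TensorProduct.smul_tmul']

theorem tmul_one_injective (M : Type*) [AddCommGroup M] [Module R M] [Module.IsTorsionFree R M]
    [Module.Finite R M] : Function.Injective (fun m : M => m ⊗ₜ[R] (1 : K)) := by
  have h := Module.Flat.lTensor_preserves_injective_linearMap (M := M) (Algebra.linearMap R K)
    (FaithfulSMul.algebraMap_injective R K)
  have h2 := h.comp (TensorProduct.rid R M).symm.injective
  convert h2 using 1
  ext m
  simp

variable (R K) in
/-- The `A`-module structure on `M ⊗ K` for a `Λ`-module `M`, where `A = Λ ⊗ K`. -/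
noncomputable abbrev tensorModule (M : Type*) [AddCommGroup M] [Module R M] [Module Λ M]
    [IsScalarTower R Λ M] : Module (Λ ⊗[R] K) (M ⊗[R] K) :=
  Module.compHom _ ((Module.endTensorEndAlgHom (R := R) (S := R) (A := R) (M := M) (N := K)).comp
    (Algebra.TensorProduct.map (Algebra.lsmul R R M : Λ →ₐ[R] Module.End R M)
      (Algebra.lsmul R R K : K →ₐ[R] Module.End R K))).toRingHom

variable (K) in
/-- If `Λ ⊗ K` is semisimple, then submodules of lattices are direct summands up to a scalar. -/
theorem exists_projection_up_to_scalar (hss : IsSemisimpleRing (Λ ⊗[R] K)) {M : Type*}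
    [AddCommGroup M] [Module R M] [Module Λ M] [IsScalarTower R Λ M] [Module.IsTorsionFree R M]
    [Module.Finite R M] (N : Submodule Λ M) :
    ∃ (r : R) (p : M →ₗ[Λ] M), r ≠ 0 ∧ (∀ x, p x ∈ N) ∧ ∀ x ∈ N, p x = r • x := by
  let _ := tensorModule R K (Λ := Λ) M
  have hact : ∀ (a : Λ) (k : K) (m : M) (x : K),
      (a ⊗ₜ[R] k : Λ ⊗[R] K) • (m ⊗ₜ[R] x : M ⊗[R] K) = (a • m) ⊗ₜ[R] (k * x) := fun _ _ _ _ => rfl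
  have hcomm : ∀ (r : R) (a : Λ ⊗[R] K) (v : M ⊗[R] K), r • (a • v) = a • (r • v) := by
    intro r a v
    exact (LinearMap.map_smul _ r v).symm
  have hR : ∀ (r : R) (v : M ⊗[R] K), r • v = (algebraMap R Λ r ⊗ₜ[R] (1 : K) : Λ ⊗[R] K) • v := by
    intro r v
    induction v using TensorProduct.induction_on with
    | zero => simp
    | tmul m x => rw [hact, algebraMap_smul, one_mul, TensorProduct.smul_tmul']
    | add v w hv hw => rw [smul_add, smul_add, hv, hw]
  have hj := tmul_one_injective (R := R) (K := K) M
  -- The span of `N` over `K`, written through denominators. Semisimplicity supplies a projection of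
  -- `M ⊗ K` onto it.
  let NK : Submodule (Λ ⊗[R] K) (M ⊗[R] K) :=
    { carrier := {v | ∃ (r : R) (n : M), r ≠ 0 ∧ n ∈ N ∧ r • v = n ⊗ₜ[R] (1 : K)}
      zero_mem' := ⟨1, 0, one_ne_zero, zero_mem _, by simp⟩
      add_mem' := by
        rintro v w ⟨r, m, hr, hm, h1⟩ ⟨s, n, hs, hn, h2⟩
        refine ⟨r * s, s • m + r • n, mul_ne_zero hr hs,
          add_mem (N.smul_of_tower_mem s hm) (N.smul_of_tower_mem r hn), ?_⟩
        rw [smul_add, TensorProduct.add_tmul, mul_smul r s w, mul_comm r s, mul_smul, h1, h2,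
          TensorProduct.smul_tmul', TensorProduct.smul_tmul']
      smul_mem' := by
        rintro a v ⟨r, n, hr, hn, h⟩
        obtain ⟨s, l, hs, hl⟩ := exists_smul_eq_tmul_one (R := R) a
        refine ⟨s * r, l • n, mul_ne_zero hs hr, N.smul_mem l hn, ?_⟩
        rw [mul_smul, hcomm, h]
        have : s • a • (n ⊗ₜ[R] (1 : K) : M ⊗[R] K) = (s • a) • (n ⊗ₜ[R] (1 : K) : M ⊗[R] K) := by
          rw [hR, smul_smul]
          congr 1
          rw [← Algebra.TensorProduct.algebraMap_apply, Algebra.smul_def]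
        rw [this, hl, hact, one_mul] }
  obtain ⟨C, hC⟩ := exists_isCompl NK
  let e : M ⊗[R] K →ₗ[Λ ⊗[R] K] M ⊗[R] K := NK.projection C hC
  have heR : ∀ (r : R) (v : M ⊗[R] K), e (r • v) = r • e v := fun r v => by rw [hR, map_smul, ← hR]
  -- A common denominator for the projection exists because `M` is finitely generated; the statement
  -- ranges over submodules of `M` so that generators can be added one by one.
  have hex : ∀ U : Submodule R M, U.FG → ∃ r : R, r ≠ 0 ∧ ∀ m ∈ U, ∃ n ∈ N,
      n ⊗ₜ[R] (1 : K) = r • e (m ⊗ₜ[R] (1 : K)) := by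
    intro U hU
    induction U, hU using Submodule.fg_induction with
    | singleton x =>
      obtain ⟨r, n, hr, hn, h⟩ : e (x ⊗ₜ[R] (1 : K)) ∈ NK := Submodule.projection_apply_mem _ _
      refine ⟨r, hr, fun m hm => ?_⟩
      obtain ⟨s, rfl⟩ := Submodule.mem_span_singleton.mp hm
      refine ⟨s • n, N.smul_of_tower_mem s hn, ?_⟩
      rw [← TensorProduct.smul_tmul', ← TensorProduct.smul_tmul', heR, ← h, smul_comm]
    | sup U₁ U₂ _ _ h₁ h₂ =>
      obtain ⟨r, hr, h₁⟩ := h₁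
      obtain ⟨s, hs, h₂⟩ := h₂
      refine ⟨r * s, mul_ne_zero hr hs, fun m hm => ?_⟩
      obtain ⟨a, ha, b, hb, rfl⟩ := Submodule.mem_sup.mp hm
      obtain ⟨a', ha', haa⟩ := h₁ a ha
      obtain ⟨b', hb', hbb⟩ := h₂ b hb
      refine ⟨s • a' + r • b', add_mem (N.smul_of_tower_mem s ha') (N.smul_of_tower_mem r hb'), ?_⟩
      rw [TensorProduct.add_tmul, ← TensorProduct.smul_tmul', ← TensorProduct.smul_tmul', haa, hbb,
        TensorProduct.add_tmul, map_add, smul_add, mul_smul r s (e (b ⊗ₜ[R] 1)), mul_comm r s,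
        mul_smul]
  obtain ⟨r, hr, h⟩ := hex ⊤ Module.Finite.fg_top
  choose p hpN hp using fun m => h m trivial
  refine ⟨r, { toFun := p, map_add' := ?_, map_smul' := ?_ }, hr, hpN, ?_⟩
  · intro x y
    apply hj
    simp only [TensorProduct.add_tmul, hp, map_add, smul_add]
  · intro a x
    apply hj
    have h1 : ∀ y : M, (a • y) ⊗ₜ[R] (1 : K) =
        (a ⊗ₜ[R] (1 : K) : Λ ⊗[R] K) • (y ⊗ₜ[R] (1 : K) : M ⊗[R] K) := fun y => by
      rw [hact, one_mul]
    simp only [RingHom.id_apply, hp, h1, map_smul, hcomm]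
  · intro x hx
    apply hj
    have h1 : e (x ⊗ₜ[R] (1 : K)) = x ⊗ₜ[R] (1 : K) :=
      Submodule.projection_apply_of_mem_left hC ⟨1, x, one_ne_zero, hx, one_smul _ _⟩
    change p x ⊗ₜ[R] (1 : K) = (r • x) ⊗ₜ[R] (1 : K)
    rw [hp, h1, TensorProduct.smul_tmul']

variable (K) in
/-- If `Λ ⊗ K` is semisimple, then surjections of lattices split up to a scalar. -/
theorem exists_section_up_to_scalar (hss : IsSemisimpleRing (Λ ⊗[R] K)) {M N : Type*}
    [AddCommGroup M] [Module R M] [Module Λ M] [IsScalarTower R Λ M] [Module.IsTorsionFree R M]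
    [Module.Finite R M] [AddCommGroup N] [Module R N] [Module Λ N] [IsScalarTower R Λ N]
    (f : M →ₗ[Λ] N) (hf : Function.Surjective f) :
    ∃ (r : R) (s : N →ₗ[Λ] M), r ≠ 0 ∧ ∀ x, f (s x) = r • x := by
  obtain ⟨r, p, hr, hp, hp'⟩ := exists_projection_up_to_scalar K hss (LinearMap.ker f)
  let q : M →ₗ[Λ] M :=
    { toFun := fun x => r • x - p x
      map_add' := fun x y => by simp only [smul_add, map_add]; abel
      map_smul' := fun a x => by simp only [map_smul, smul_sub, RingHom.id_apply, smul_comm a r] }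
  have hq : LinearMap.ker f ≤ LinearMap.ker q := fun x hx => by
    change r • x - p x = 0
    rw [hp' x hx, sub_self]
  refine ⟨r, (LinearMap.ker f).liftQ q hq ∘ₗ (f.quotKerEquivOfSurjective hf).symm.toLinearMap, hr,
    fun x => ?_⟩
  obtain ⟨m, rfl⟩ := hf x
  have h1 : (f.quotKerEquivOfSurjective hf).symm (f m) = (LinearMap.ker f).mkQ m := by
    rw [LinearEquiv.symm_apply_eq]
    rfl
  have h2 : f (p m) = 0 := hp m
  rw [LinearMap.comp_apply, LinearEquiv.coe_coe, h1, Submodule.mkQ_apply, Submodule.liftQ_apply]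
  change f (r • m - p m) = _
  rw [map_sub, h2, sub_zero, map_smul_base]

end Semisimple

theorem isTorsionFree_of_projective (R : Type*) [CommRing R] (Λ : Type*) [Ring Λ] [Algebra R Λ]
    [Module.IsTorsionFree R Λ] (M : Type*) [AddCommGroup M] [Module R M] [Module Λ M]
    [IsScalarTower R Λ M] [Module.Projective Λ M] : Module.IsTorsionFree R M := by
  obtain ⟨s, hs⟩ := Module.projective_def.mp (inferInstance : Module.Projective Λ M)
  exact hs.injective.moduleIsTorsionFree s fun r m => map_smul_base s r m

/-- The ideal is principal, so `IY` is zero or isomorphic to `Y` by multiplication with a generator.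
-/
theorem projective_idealSubmodule {R : Type*} [CommRing R] [IsDomain R] [IsPrincipalIdealRing R]
    (I : Ideal R) {Λ : Type u} [Ring Λ] [Algebra R Λ] [Module.IsTorsionFree R Λ]
    (Y : Type u) [AddCommGroup Y] [Module R Y] [Module Λ Y] [IsScalarTower R Λ Y]
    [Module.Projective Λ Y] : Module.Projective Λ (idealSubmodule I Λ Y) := by
  have _ := isTorsionFree_of_projective R Λ Y
  obtain ⟨π, rfl⟩ := (IsPrincipalIdealRing.principal I).principal
  let f : Y →ₗ[Λ] Y :=
    { toFun := fun x => π • x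
      map_add' := smul_add π
      map_smul' := fun a x => smul_comm π a x }
  have hrange : LinearMap.range f = idealSubmodule (Ideal.span {π}) Λ Y := by
    apply le_antisymm
    · rintro _ ⟨x, rfl⟩
      exact smul_mem_idealSubmodule (Ideal.mem_span_singleton_self π) x
    · refine idealSubmodule_le fun r hr x => ?_
      obtain ⟨s, rfl⟩ := Ideal.mem_span_singleton'.mp hr
      exact ⟨s • x, by change π • s • x = _; rw [smul_smul, mul_comm]⟩
  change Module.Projective Λ (idealSubmodule (Ideal.span {π}) Λ Y)
  rw [← hrange]
  by_cases hπ : π = 0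
  · have : f = 0 := by ext x; change π • x = 0; rw [hπ, zero_smul]
    rw [this, LinearMap.range_zero]
    infer_instance
  · refine Module.Projective.of_equiv (LinearEquiv.ofInjective f fun x y h => ?_)
    exact smul_right_injective Y hπ h

/-! ### Indecomposables isomorphic to their radical. -/

namespace PrSub

variable {Λ : Type u} [Ring Λ]

/-- An indecomposable module of a class which is isomorphic to its radical in the class: nonzero
maps to it are split epimorphisms followed by a power of an injective endomorphism. -/
def IsStuck (D : PrSub Λ) (P : Type u) [AddCommGroup P] [Module Λ P] : Prop :=
  D.mem P ∧ Nontrivial P ∧ ∃ t : Module.End Λ P, Function.Injective t ∧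
    ∀ (Z : Type u) [AddCommGroup Z] [Module Λ Z], D.mem Z → ∀ f : Z →ₗ[Λ] P, f ≠ 0 →
      ∃ (n : ℕ) (g : Z →ₗ[Λ] P) (s : P →ₗ[Λ] Z), (∀ z, f z = (t ^ n) (g z)) ∧ ∀ x, g (s x) = x

/-- Every nonzero module of the class has a direct summand which is isomorphic to its radical. -/
def IsTerminal (D : PrSub Λ) : Prop :=
  ∀ (Y : Type u) [AddCommGroup Y] [Module Λ Y], D.mem Y → Nontrivial Y →
    ∃ (P : Type u) (_ : AddCommGroup P) (_ : Module Λ P) (i : P →ₗ[Λ] Y) (r : Y →ₗ[Λ] P),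
      D.IsStuck P ∧ ∀ x, r (i x) = x

section Stuck

/-- The complement of `P` in `Q ⊆ P` has rank zero and is torsion-free, so it vanishes and `Q ≅ P`.
-/
theorem exists_range_eq_of_retract (R : Type u₁) [CommRing R] [IsDomain R] [IsPrincipalIdealRing R]
    [Algebra R Λ] [Module.Finite R Λ] [Module.IsTorsionFree R Λ] {P : Type u}
    [AddCommGroup P] [Module Λ P] [Module.Finite Λ P] [Module.Projective Λ P] (Q : Submodule Λ P) (i : P →ₗ[Λ] Q) (r : Q →ₗ[Λ] P)
    (hir : ∀ x, r (i x) = x) :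
    ∃ t : Module.End Λ P, Function.Injective t ∧ LinearMap.range t = Q := by
  let _ : Module R P := Module.compHom P (algebraMap R Λ)
  have _ : IsScalarTower R Λ P := IsScalarTower.of_algebraMap_smul fun _ _ => rfl
  have _ : Module.Finite R P := Module.Finite.trans Λ P
  have _ := isTorsionFree_of_projective R Λ P
  let ι : LinearMap.ker r →ₗ[Λ] P := Q.subtype ∘ₗ (LinearMap.ker r).subtype
  have hι : Function.Injective ι := Q.injective_subtype.comp (LinearMap.ker r).injective_subtype
  have _ : Module.Finite R (LinearMap.ker r) := Module.Finite.of_injective (ι.restrictScalars R) hι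
  have _ : Module.IsTorsionFree R (LinearMap.ker r) :=
    hι.moduleIsTorsionFree ι fun a x => map_smul_base ι a x
  have h1 := ((LinearMap.equivProdKer i r hir).restrictScalars R).finrank_eq
  rw [Module.finrank_prod] at h1
  have h3 : Module.finrank R Q ≤ Module.finrank R P :=
    Submodule.finrank_le (Q.restrictScalars R)
  have h4 : Module.finrank R (LinearMap.ker r) = 0 := by lia
  have h5 : Subsingleton (LinearMap.ker r) := Module.finrank_zero_iff.mp h4
  have hr : Function.Injective r :=
    LinearMap.ker_eq_bot.mp (Submodule.subsingleton_iff_eq_bot.mp h5)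
  refine ⟨Q.subtype ∘ₗ i, Q.injective_subtype.comp (Function.LeftInverse.injective hir), ?_⟩
  refine le_antisymm (by rintro _ ⟨x, rfl⟩; exact (i x).2) fun x hx => ⟨r ⟨x, hx⟩, ?_⟩
  have : i (r ⟨x, hx⟩) = ⟨x, hx⟩ := hr (hir _)
  change ((i (r ⟨x, hx⟩) : Q) : P) = x
  rw [this]

/-- A map into `P` that does not split lands in `Q = tP` and can be divided by `t`. For nonzero `f`
this stops: `t` is topologically nilpotent because it is not surjective, so the submodules `t ^ n P`
intersect in zero by Krull's theorem. -/
theorem IsRadical.isStuck (R : Type u₁) [CommRing R] [IsDomain R] [IsDiscreteValuationRing R]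
    [IsAdicComplete (IsLocalRing.maximalIdeal R) R] [Algebra R Λ] [Module.Finite R Λ]
    [Module.IsTorsionFree R Λ] {D : PrSub Λ} {P : Type u} [AddCommGroup P] [Module Λ P]
    {Q : Submodule Λ P} (hQ : D.IsRadical Q) (i : P →ₗ[Λ] Q) (r : Q →ₗ[Λ] P)
    (hir : ∀ x, r (i x) = x) : D.IsStuck P := by
  have _ := D.finite hQ.mem
  have _ := D.projective hQ.mem
  set I := IsLocalRing.maximalIdeal R
  have _ : IsArtinianRing (R ⧸ I) :=
    (inferInstance : IsArtinianRing (IsLocalRing.ResidueField R))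
  obtain ⟨t, ht, htQ⟩ := exists_range_eq_of_retract R Q i r hir
  refine ⟨hQ.mem, hQ.nontrivial, t, ht, fun Z _ _ hZ f hf => ?_⟩
  by_contra hcon
  push Not at hcon
  let _ : Module R P := Module.compHom P (algebraMap R Λ)
  have _ : IsScalarTower R Λ P := IsScalarTower.of_algebraMap_smul fun _ _ => rfl
  have _ : Module.Finite R P := Module.Finite.trans Λ P
  have h1 : ∀ n : ℕ, ∃ g : Z →ₗ[Λ] P, ∀ z, f z = (t ^ n) (g z) := by
    intro n
    induction n with
    | zero => exact ⟨f, fun _ => rfl⟩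
    | succ n ih =>
      obtain ⟨g, hg⟩ := ih
      rcases hQ.split_or_mem Z hZ g with ⟨s, hs⟩ | h
      · obtain ⟨x, hx⟩ := hcon n g s hg
        exact absurd (LinearMap.congr_fun hs x) hx
      · let e := LinearEquiv.ofInjective t ht
        let g' : Z →ₗ[Λ] P := e.symm.toLinearMap ∘ₗ LinearMap.codRestrict (LinearMap.range t) g
          (fun z => by rw [htQ]; exact h z)
        have hg' : ∀ z, t (g' z) = g z := fun z => congrArg Subtype.val (e.apply_symm_apply _)
        exact ⟨g', fun z => by rw [hg, pow_succ, Module.End.mul_apply, hg']⟩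
  obtain ⟨N, hN⟩ : ∃ n : ℕ, ∀ x, (t ^ n) x ∈ idealSubmodule I Λ P := by
    rcases bijective_or_range_pow_le I hQ.indecomposable t with hb | h
    · exact absurd (htQ ▸ LinearMap.range_eq_top.mpr hb.2) hQ.ne_top
    · exact h
  have h2 : ∀ k : ℕ, ∀ x, ((t ^ N) ^ k) x ∈ (I ^ k • ⊤ : Submodule R P) := by
    intro k
    induction k with
    | zero => intro x; simp
    | succ k ih =>
      intro x
      rw [pow_succ (t ^ N) k, Module.End.mul_apply, pow_succ' I k, mul_smul]
      have h3 : ∀ y ∈ (I • ⊤ : Submodule R P), ((t ^ N) ^ k) y ∈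
          (I • (I ^ k • ⊤ : Submodule R P) : Submodule R P) := by
        intro y hy
        induction hy using Submodule.smul_induction_on' with
        | smul r hr n _ =>
          rw [map_smul_base]
          exact Submodule.smul_mem_smul hr (ih n)
        | add x _ y _ hx hy => rw [map_add]; exact add_mem hx hy
      exact h3 _ (hN x)
  apply hf
  ext z
  have h4 : f z ∈ (⨅ k : ℕ, I ^ k • ⊤ : Submodule R P) := by
    rw [Submodule.mem_iInf]
    intro k
    obtain ⟨g, hg⟩ := h1 (N * k)
    rw [hg, pow_mul]
    exact h2 k _
  rw [Ideal.iInf_pow_smul_eq_bot_of_isLocalRing I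
    (IsLocalRing.maximalIdeal.isMaximal R).ne_top] at h4
  exact h4

variable {R : Type u₁} [CommRing R] [IsDomain R] [IsDiscreteValuationRing R]
  [IsAdicComplete (IsLocalRing.maximalIdeal R) R] [Algebra R Λ] [Module.Finite R Λ]
  [Module.IsTorsionFree R Λ] (K : Type u₂) [Field K] [Algebra R K] [IsFractionRing R K]

/-- Semisimplicity reverses the nonzero map from `P` to `Y` into a nonzero map from `Y` to `P`, and
the latter contains a split epimorphism because `P` is stuck. -/
theorem exists_reachable_isTerminal (hss : IsSemisimpleRing (Λ ⊗[R] K)) (hgl : GlobalDimLE Λ 2) :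
    ∃ D : PrSub Λ, D.Reachable ∧ D.IsTerminal ∧ ∃ (c : R) (T : Submodule Λ Λ), c ≠ 0 ∧
      D.IsTrace T ∧ algebraMap R Λ c ∈ T := by
  have _ : IsArtinianRing (R ⧸ IsLocalRing.maximalIdeal R) :=
    (inferInstance : IsArtinianRing (IsLocalRing.ResidueField R))
  obtain ⟨D, hD, ⟨n, T, hT, hn⟩, h⟩ := exists_reachable_terminal (IsLocalRing.maximalIdeal R) hgl
    fun Y _ _ _ _ _ _ => projective_idealSubmodule _ Y
  obtain ⟨π, hπ⟩ := IsDiscreteValuationRing.exists_irreducible R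
  refine ⟨D, hD, fun Y _ _ hY hYn => ?_, π ^ n, T, pow_ne_zero n hπ.ne_zero, hT,
    hn _ (Ideal.pow_mem_pow ?_ n)⟩
  · obtain ⟨P, _, _, Q, f, hf, hQ, i, r, hir⟩ := h Y hY hYn
    have hP := hQ.isStuck R i r (LinearMap.congr_fun hir)
    have _ := D.finite hY
    have _ := D.projective hY
    have _ := D.finite hQ.mem
    have _ := D.projective hQ.mem
    let _ : Module R P := Module.compHom P (algebraMap R Λ)
    have _ : IsScalarTower R Λ P := IsScalarTower.of_algebraMap_smul fun _ _ => rfl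
    have _ : Module.Finite R P := Module.Finite.trans Λ P
    let _ : Module R Y := Module.compHom Y (algebraMap R Λ)
    have _ : IsScalarTower R Λ Y := IsScalarTower.of_algebraMap_smul fun _ _ => rfl
    have _ : Module.Finite R Y := Module.Finite.trans Λ Y
    have _ := isTorsionFree_of_projective R Λ P
    have _ := isTorsionFree_of_projective R Λ Y
    obtain ⟨a, s, ha, hs⟩ := exists_section_up_to_scalar K hss f.rangeRestrict
      f.surjective_rangeRestrict
    -- Projection to the image of `f` followed by a section of `f`, both up to scalars: `f ∘ q` acts
    -- on that image as `a * b`, so `q ≠ 0`.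
    obtain ⟨b, p, hb, hp, hp'⟩ := exists_projection_up_to_scalar K hss (LinearMap.range f)
    let q : Y →ₗ[Λ] P := s ∘ₗ LinearMap.codRestrict (LinearMap.range f) p hp
    have hq : ∀ x, f (q (f x)) = a • b • f x := by
      intro x
      have h1 : f (q (f x)) = a • p (f x) := congrArg Subtype.val (hs ⟨p (f x), hp _⟩)
      rw [h1, hp' _ ⟨x, rfl⟩]
    have hq0 : q ≠ 0 := by
      intro hq0
      apply hf
      ext x
      have h1 := hq x
      rw [hq0, LinearMap.zero_apply, map_zero] at h1
      exact (smul_eq_zero_iff_right hb).mp ((smul_eq_zero_iff_right ha).mp h1.symm)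
    obtain ⟨-, -, t, -, ht⟩ := id hP
    obtain ⟨n, g, s, -, hgs⟩ := ht Y hY q hq0
    exact ⟨P, _, _, s, g, hP, hgs⟩
  · exact (IsLocalRing.mem_maximalIdeal _).mpr hπ.not_isUnit

end Stuck

/-! ### Images and kernels in a terminal class. -/

section Terminal

variable {D : PrSub Λ} [IsNoetherianRing Λ]

/-- Maps between modules of a terminal class have images in the class. -/
theorem IsTerminal.exists_factorization (hD : D.IsTerminal) {W : Type u} [AddCommGroup W]
    [Module Λ W] (hW : D.mem W) {Z : Type u} [AddCommGroup Z] [Module Λ Z] (hZ : D.mem Z)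
    (f : Z →ₗ[Λ] W) :
    ∃ (V : Type u) (_ : AddCommGroup V) (_ : Module Λ V) (g : Z →ₗ[Λ] V) (m : V →ₗ[Λ] W),
      D.mem V ∧ Function.Surjective g ∧ Function.Injective m ∧ ∀ z, f z = m (g z) := by
  refine D.induction_of_split (p := fun W _ _ => ∀ (Z : Type u) [AddCommGroup Z] [Module Λ Z],
    D.mem Z → ∀ f : Z →ₗ[Λ] W, ∃ (V : Type u) (_ : AddCommGroup V) (_ : Module Λ V)
      (g : Z →ₗ[Λ] V) (m : V →ₗ[Λ] W), D.mem V ∧ Function.Surjective g ∧ Function.Injective m ∧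
        ∀ z, f z = m (g z)) (fun W _ _ hW => ?_) W hW Z hZ f
  rcases subsingleton_or_nontrivial W with _ | _
  · exact Or.inl fun Z _ _ _ f => ⟨PUnit, _, _, 0, 0, D.punit, fun x => ⟨0, Subsingleton.elim _ _⟩,
      Function.injective_of_subsingleton _, fun z => Subsingleton.elim _ _⟩
  · obtain ⟨P, _, _, i, r, hP, hir⟩ := hD W hW inferInstance
    obtain ⟨hPD, hPn, t, ht, htf⟩ := hP
    refine Or.inr ⟨P, _, _, hPn, i, r, hir, fun ih Z _ _ hZ f => ?_⟩
    by_cases hrf : r ∘ₗ f = 0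
    · obtain ⟨V, _, _, g, m, hV, hg, hm, hgm⟩ := ih Z hZ
        (LinearMap.codRestrict _ f (LinearMap.congr_fun hrf))
      exact ⟨V, _, _, g, (LinearMap.ker r).subtype ∘ₗ m, hV, hg,
        (LinearMap.ker r).injective_subtype.comp hm, fun z => congrArg Subtype.val (hgm z)⟩
    · obtain ⟨n, g, s, hfg, hgs⟩ := htf Z hZ (r ∘ₗ f) hrf
      have hker : ∀ z : LinearMap.ker g, r (f z) = 0 := by
        intro z
        have h1 := hfg z
        rw [show g z = 0 from z.2, map_zero] at h1
        exact h1
      obtain ⟨V, _, _, g', m, hV, hg, hm, hgm⟩ := ih (LinearMap.ker g)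
        (mem_ker_of_comp_eq_id hZ s g hgs)
        (LinearMap.codRestrict _ (f ∘ₗ (LinearMap.ker g).subtype) hker)
      let q : Z →ₗ[Λ] LinearMap.ker g :=
        LinearMap.codRestrict _ (LinearMap.id - s ∘ₗ g) fun x => by simp [hgs]
      have hgm' : ∀ z : LinearMap.ker g, f z = m (g' z) := fun z => congrArg Subtype.val (hgm z)
      have htn : Function.Injective (t ^ n) := by
        rw [Module.End.coe_pow]
        exact ht.iterate n
      refine ⟨P × V, _, _, g.prod (g' ∘ₗ q),
        (f ∘ₗ s).coprod ((LinearMap.ker r).subtype ∘ₗ m), D.prod hPD hV, ?_, ?_, ?_⟩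
      · rintro ⟨x, v⟩
        obtain ⟨z, rfl⟩ := hg v
        have hgz : g (z : Z) = 0 := z.2
        refine ⟨s x + z, Prod.ext ?_ ?_⟩
        · simp [hgs, hgz]
        · have : q (s x + z) = z := Subtype.ext (by simp [q, hgs, hgz])
          change g' (q (s x + z)) = g' z
          rw [this]
      · rw [← LinearMap.ker_eq_bot, eq_bot_iff]
        rintro ⟨x, v⟩ hxv
        have h0 : f (s x) + (m v : W) = 0 := hxv
        have h1 : (t ^ n) x = 0 := by
          have h2 := congrArg r h0
          rw [map_add, map_zero, show r (m v : W) = 0 from (m v).2, add_zero] at h2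
          rw [← h2, ← hgs x]
          simp only [hgs]
          have := hfg (s x)
          rw [hgs] at this
          exact this.symm
        have hx : x = 0 := htn (by rw [h1, map_zero])
        subst hx
        have h3 : m v = 0 := Subtype.ext (by simpa using h0)
        have hv : v = 0 := hm (by rw [h3, map_zero])
        rw [hv]
        rfl
      · intro z
        have h1 : s (g z) + (q z : Z) = z := by simp [q]
        conv_lhs => rw [← h1]
        rw [map_add, hgm']
        rfl

/-- The image is in the class, hence projective, so the kernel is a direct summand of the source. -/
theorem IsTerminal.mem_ker (hD : D.IsTerminal) {W : Type u} [AddCommGroup W]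
    [Module Λ W] (hW : D.mem W) {Z : Type u} [AddCommGroup Z] [Module Λ Z] (hZ : D.mem Z)
    (f : Z →ₗ[Λ] W) : D.mem (LinearMap.ker f) := by
  obtain ⟨V, _, _, g, m, hV, hg, hm, hgm⟩ := hD.exists_factorization hW hZ f
  have _ := D.projective hV
  obtain ⟨s, hs⟩ := Module.projective_lifting_property g LinearMap.id hg
  have h : LinearMap.ker f = LinearMap.ker g := by
    ext z
    rw [LinearMap.mem_ker, LinearMap.mem_ker, hgm, map_eq_zero_iff m hm]
  rw [h]
  exact mem_ker_of_comp_eq_id hZ s g (LinearMap.congr_fun hs)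

end Terminal

end PrSub

/-! ### Fractions, stabilizers and left orders. -/

section TensorFractionField

variable {R : Type u₁} [CommRing R] {K : Type u₂} [Field K] [Algebra R K]
  {Λ : Type u} [Ring Λ] [Algebra R Λ]

theorem tmul_one_mul_tmul_one (a b : Λ) :
    (a ⊗ₜ[R] (1 : K)) * (b ⊗ₜ[R] (1 : K)) = (a * b) ⊗ₜ[R] (1 : K) := by
  rw [Algebra.TensorProduct.tmul_mul_tmul, one_mul]

theorem algebraMap_mul_tmul_one (r : R) (b : Λ) :
    (algebraMap R Λ r * b) ⊗ₜ[R] (1 : K) = r • (b ⊗ₜ[R] (1 : K)) := by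
  rw [TensorProduct.smul_tmul', Algebra.smul_def]

/-- The element `a` of `Λ ⊗ K` stabilizes the lattice `M`. -/
def Stabilizes (a : Λ ⊗[R] K) (M : Type*) [AddCommGroup M] [Module Λ M] : Prop :=
  ∀ (r : R) (l : Λ), r ≠ 0 → r • a = l ⊗ₜ[R] (1 : K) →
    ∀ x : M, ∃ y : M, algebraMap R Λ r • y = l • x

theorem Stabilizes.retract {a : Λ ⊗[R] K} {M N : Type*} [AddCommGroup M] [Module Λ M]
    [AddCommGroup N] [Module Λ N] (h : Stabilizes a M) (i : N →ₗ[Λ] M) (s : M →ₗ[Λ] N)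
    (his : ∀ x, s (i x) = x) : Stabilizes a N := by
  intro r l hr hl x
  obtain ⟨y, hy⟩ := h r l hr hl (i x)
  exact ⟨s y, by rw [← map_smul, hy, map_smul, his]⟩

theorem Stabilizes.of_retracts {a : Λ ⊗[R] K} {M N : Type*} [AddCommGroup M] [Module Λ M]
    [AddCommGroup N] [Module Λ N] (i : N →ₗ[Λ] M) (s : M →ₗ[Λ] N) (his : ∀ x, s (i x) = x)
    (h : Stabilizes a N) (h' : Stabilizes a (LinearMap.ker s)) : Stabilizes a M := by
  intro r l hr hl x
  obtain ⟨y, hy⟩ := h r l hr hl (s x)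
  obtain ⟨z, hz⟩ := h' r l hr hl ⟨x - i (s x), by simp [his]⟩
  refine ⟨i y + z, ?_⟩
  have hz' : algebraMap R Λ r • (z : M) = l • (x - i (s x)) := congrArg Subtype.val hz
  rw [smul_add, ← map_smul, hy, hz', map_smul, smul_sub]
  abel

variable (R K) in
/-- The left order `{a ∈ A | a T ⊆ T}` of a left ideal `T` of `Λ`. -/
def leftOrder (T : Submodule Λ Λ) : Subalgebra R (Λ ⊗[R] K) where
  carrier := {a | ∀ x ∈ T, ∃ y ∈ T, a * (x ⊗ₜ[R] (1 : K)) = y ⊗ₜ[R] (1 : K)}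
  mul_mem' {a b} ha hb x hx := by
    obtain ⟨y, hy, h1⟩ := hb x hx
    obtain ⟨z, hz, h2⟩ := ha y hy
    exact ⟨z, hz, by rw [mul_assoc, h1, h2]⟩
  add_mem' {a b} ha hb x hx := by
    obtain ⟨y, hy, h1⟩ := ha x hx
    obtain ⟨z, hz, h2⟩ := hb x hx
    exact ⟨y + z, add_mem hy hz, by rw [add_mul, h1, h2, TensorProduct.add_tmul]⟩
  algebraMap_mem' r x hx := ⟨algebraMap R Λ r • x, T.smul_mem _ hx, by
    rw [smul_eq_mul, algebraMap_mul_tmul_one, Algebra.smul_def]⟩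

theorem tmul_one_mem_leftOrder (T : Submodule Λ Λ) (a : Λ) : a ⊗ₜ[R] (1 : K) ∈ leftOrder R K T :=
  fun x hx => ⟨a • x, T.smul_mem a hx, tmul_one_mul_tmul_one a x⟩

variable [IsFractionRing R K]

theorem smul_tensor_injective {r : R} (hr : r ≠ 0) {M : Type*} [AddCommGroup M] [Module R M]
    {v w : M ⊗[R] K} (h : r • v = r • w) : v = w := by
  have hr' : algebraMap R K r ≠ 0 := by rwa [ne_eq, FaithfulSMul.algebraMap_eq_zero_iff]
  have h1 : ∀ v : M ⊗[R] K, LinearMap.lTensor M (LinearMap.mulLeft R (algebraMap R K r)⁻¹) (r • v) =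
      v := by
    intro v
    induction v using TensorProduct.induction_on with
    | zero => simp
    | tmul m x =>
      rw [← TensorProduct.tmul_smul, LinearMap.lTensor_tmul, LinearMap.mulLeft_apply,
        Algebra.smul_def, inv_mul_cancel_left₀ hr']
    | add v w hv hw => rw [smul_add, map_add, hv, hw]
  rw [← h1 v, h, h1]

theorem exists_smul_eq {c : R} (hc : c ≠ 0) (v : Λ ⊗[R] K) : ∃ a : Λ ⊗[R] K, c • a = v := by
  have hc' : algebraMap R K c ≠ 0 := by rwa [ne_eq, FaithfulSMul.algebraMap_eq_zero_iff]
  refine ⟨(1 ⊗ₜ (algebraMap R K c)⁻¹) * v, ?_⟩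
  rw [← smul_mul_assoc, ← TensorProduct.tmul_smul, Algebra.smul_def, mul_inv_cancel₀ hc']
  exact one_mul v

variable [IsDomain R]

theorem exists_common_denominator (U : Submodule R (Λ ⊗[R] K)) (hU : U.FG) :
    ∃ r : R, r ≠ 0 ∧ ∀ u ∈ U, ∃ a : Λ, r • u = a ⊗ₜ[R] (1 : K) := by
  induction U, hU using Submodule.fg_induction with
  | singleton x =>
    obtain ⟨r, a, hr, h⟩ := exists_smul_eq_tmul_one (R := R) x
    refine ⟨r, hr, fun u hu => ?_⟩
    obtain ⟨s, rfl⟩ := Submodule.mem_span_singleton.mp hu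
    exact ⟨s • a, by rw [smul_comm, h, TensorProduct.smul_tmul']⟩
  | sup U₁ U₂ _ _ h₁ h₂ =>
    obtain ⟨r, hr, h₁⟩ := h₁
    obtain ⟨s, hs, h₂⟩ := h₂
    refine ⟨r * s, mul_ne_zero hr hs, fun u hu => ?_⟩
    obtain ⟨x, hx, y, hy, rfl⟩ := Submodule.mem_sup.mp hu
    obtain ⟨a, ha⟩ := h₁ x hx
    obtain ⟨b, hb⟩ := h₂ y hy
    refine ⟨s • a + r • b, ?_⟩
    rw [smul_add, TensorProduct.add_tmul, mul_smul r s y, mul_comm r s, mul_smul, ha, hb,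
      TensorProduct.smul_tmul', TensorProduct.smul_tmul']

variable [IsPrincipalIdealRing R] [Module.Finite R Λ] [Module.IsTorsionFree R Λ]

theorem tmul_one_inj {a b : Λ} : a ⊗ₜ[R] (1 : K) = b ⊗ₜ[R] (1 : K) ↔ a = b :=
  (tmul_one_injective (R := R) (K := K) Λ).eq_iff

theorem mem_leftOrder_iff {T : Submodule Λ Λ} {a : Λ ⊗[R] K} :
    a ∈ leftOrder R K T ↔ Stabilizes a T := by
  constructor
  · intro h r l hr hl x
    obtain ⟨y, hy, hxy⟩ := h x x.2
    refine ⟨⟨y, hy⟩, Subtype.ext ((tmul_one_inj (R := R) (K := K)).mp ?_)⟩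
    change (algebraMap R Λ r * y) ⊗ₜ[R] (1 : K) = (l * (x : Λ)) ⊗ₜ[R] (1 : K)
    rw [algebraMap_mul_tmul_one, ← hxy, ← tmul_one_mul_tmul_one, ← hl, smul_mul_assoc]
  · intro h x hx
    obtain ⟨r, l, hr, hl⟩ := exists_smul_eq_tmul_one (R := R) a
    obtain ⟨⟨y, hy⟩, hxy⟩ := h r l hr hl ⟨x, hx⟩
    refine ⟨y, hy, smul_tensor_injective hr ?_⟩
    have hxy' : algebraMap R Λ r * y = l * x := congrArg Subtype.val hxy
    rw [← smul_mul_assoc, hl, tmul_one_mul_tmul_one, ← hxy', algebraMap_mul_tmul_one]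

/-- Multiplication by `c` embeds `S` into the finitely generated torsion-free module `Λ`. -/
theorem isROrder_of_smul_mem (S : Subalgebra R (Λ ⊗[R] K)) {c : R} (hc : c ≠ 0)
    (h : ∀ a ∈ S, ∃ l : Λ, c • a = l ⊗ₜ[R] (1 : K)) : IsROrder R S := by
  choose f hf using h
  let g : S →ₗ[R] Λ :=
    { toFun := fun a => f a a.2
      map_add' := fun a b => (tmul_one_inj (R := R) (K := K)).mp (by
        rw [TensorProduct.add_tmul, ← hf, ← hf, ← hf, ← smul_add]
        rfl)
      map_smul' := fun r a => (tmul_one_inj (R := R) (K := K)).mp (by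
        rw [← hf, RingHom.id_apply, ← TensorProduct.smul_tmul', ← hf, smul_comm]
        rfl) }
  have hg : Function.Injective g := by
    intro a b hab
    have h1 : f a a.2 = f b b.2 := hab
    refine Subtype.ext (smul_tensor_injective hc ?_)
    rw [hf a a.2, hf b b.2, h1]
  have _ : Module.Finite R S := Module.Finite.of_injective g hg
  have _ : Module.IsTorsionFree R S := hg.moduleIsTorsionFree g fun r a => map_smul g r a
  exact ⟨inferInstance, inferInstance⟩

end TensorFractionField

/-! ### The order attached to a terminal class. -/

namespace PrSub

section

variable {R : Type u₁} [CommRing R] [IsDomain R] {K : Type u₂} [Field K] [Algebra R K]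
  {Λ : Type u} [Ring Λ] [Algebra R Λ] [Module.IsTorsionFree R Λ] {D : PrSub Λ}

theorem smul_injective_of_mem {M : Type u} [AddCommGroup M] [Module Λ M] (hM : D.mem M) {r : R}
    (hr : r ≠ 0) {x y : M} (h : algebraMap R Λ r • x = algebraMap R Λ r • y) : x = y := by
  have _ := D.projective hM
  let _ : Module R M := Module.compHom M (algebraMap R Λ)
  have _ : IsScalarTower R Λ M := IsScalarTower.of_algebraMap_smul fun _ _ => rfl
  have _ := isTorsionFree_of_projective R Λ M
  exact smul_right_injective M hr h

variable [IsNoetherianRing Λ]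

/-- In a terminal class, an element stabilizing one member of full rank stabilizes all members. -/
theorem IsTerminal.stabilizes (hD : D.IsTerminal) {G : Submodule Λ Λ} (hG : D.mem G) {g : R}
    (hg0 : g ≠ 0) (hg : algebraMap R Λ g ∈ G) {a : Λ ⊗[R] K} (ha : Stabilizes a G)
    (Z : Type u) [AddCommGroup Z] [Module Λ Z] (hZ : D.mem Z) : Stabilizes a Z := by
  refine D.induction_of_split (p := fun Z _ _ => Stabilizes a Z) (fun Z _ _ hZ => ?_) Z hZ
  rcases subsingleton_or_nontrivial Z with _ | _
  · exact Or.inl fun r l _ _ x => ⟨0, Subsingleton.elim _ _⟩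
  · obtain ⟨P, _, _, i, r, ⟨hPD, hPn, t, ht, htf⟩, hir⟩ := hD Z hZ inferInstance
    refine Or.inr ⟨P, _, _, hPn, i, r, hir, fun h => ?_⟩
    obtain ⟨x, hx⟩ := exists_ne (0 : P)
    -- Evaluation `l ↦ l • x` on `G` is nonzero because `g ∈ G` and `P` is torsion-free. So the
    -- stuck module `P` is a summand of `G` and inherits stability.
    obtain ⟨n, e, s, -, hes⟩ := htf G hG (LinearMap.toSpanSingleton Λ P x ∘ₗ G.subtype) (by
      intro h0
      apply hx
      have h1 := LinearMap.congr_fun h0 ⟨_, hg⟩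
      have h2 : algebraMap R Λ g • x = algebraMap R Λ g • (0 : P) := by rw [smul_zero]; exact h1
      exact smul_injective_of_mem hPD hg0 h2)
    exact Stabilizes.of_retracts i r hir (ha.retract s e hes) h

end

section Order

variable {R : Type u₁} [CommRing R] [IsDomain R] [IsPrincipalIdealRing R]
  {K : Type u₂} [Field K] [Algebra R K] [IsFractionRing R K]
  {Λ : Type u} [Ring Λ] [Algebra R Λ] [Module.Finite R Λ] [Module.IsTorsionFree R Λ]
  {D : PrSub Λ}

/-- A terminal class contains a scalar multiple `Z` of the left order of its trace `T`. -/
theorem IsTerminal.exists_multiple_of_leftOrder (hD : D.IsTerminal) {T : Submodule Λ Λ}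
    (hT : D.IsTrace T) {c : R} (hc : c ≠ 0) (hcT : algebraMap R Λ c ∈ T) :
    ∃ Z : Submodule Λ Λ, D.mem Z ∧
      ∀ a : Λ ⊗[R] K, a ∈ leftOrder R K T ↔ ∃ z ∈ Z, c • a = z ⊗ₜ[R] (1 : K) := by
  have _ : IsNoetherianRing Λ := isNoetherian_of_tower R inferInstance
  set J := idealSubmodule (Ideal.span {c}) Λ Λ with hJ
  have hJle : ∀ Z : Submodule Λ Λ, algebraMap R Λ c ∈ Z → J ≤ Z := by
    intro Z hZ
    refine idealSubmodule_le fun r hr x => ?_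
    obtain ⟨s, rfl⟩ := Ideal.mem_span_singleton'.mp hr
    rw [Algebra.smul_def, Algebra.commutes, map_mul, ← mul_assoc]
    exact Z.smul_mem _ hZ
  have _ : IsArtinian Λ (Λ ⧸ J) := by
    have hfl := isFiniteLength_quotient_span_singleton R (mem_nonZeroDivisors_of_ne_zero hc)
    have _ := (isFiniteLength_iff_isNoetherian_isArtinian.mp hfl).2
    have _ : IsArtinianRing (R ⧸ Ideal.span {c}) := isArtinian_of_tower R inferInstance
    have _ : Module.Finite R (Λ ⧸ J) :=
      Module.Finite.of_surjective (J.mkQ.restrictScalars R) J.mkQ_surjective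
    refine isArtinian_of_smul_eq_zero (Ideal.span {c}) Λ fun r hr x => ?_
    obtain ⟨y, rfl⟩ := J.mkQ_surjective x
    rw [← map_smul_base]
    exact (Submodule.Quotient.mk_eq_zero _).mpr (smul_mem_idealSubmodule hr y)
  -- The sought multiple `cΓ` is found as a minimal left ideal of the class that lies in `T` and
  -- contains `c`; these ideals all contain `cΛ`, so minimality is taken in an artinian quotient.
  obtain ⟨_, ⟨Z, hZ, hZT, hcZ, rfl⟩, hmin⟩ := IsArtinian.set_has_minimal
    {U : Submodule Λ (Λ ⧸ J) | ∃ Z : Submodule Λ Λ, D.mem Z ∧ Z ≤ T ∧ algebraMap R Λ c ∈ Z ∧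
      Z.map J.mkQ = U} ⟨_, T, hT.1, le_rfl, hcT, rfl⟩
  have hleast : ∀ Y : Submodule Λ Λ, D.mem Y → Y ≤ Z → algebraMap R Λ c ∈ Y → Z ≤ Y := by
    intro Y hY hYZ hcY
    have h1 := (Submodule.map_mono (f := J.mkQ) hYZ).eq_of_not_lt
      (hmin _ ⟨Y, hY, hYZ.trans hZT, hcY, rfl⟩)
    have h2 := congrArg (Submodule.comap J.mkQ) h1
    rw [Submodule.comap_map_mkQ, Submodule.comap_map_mkQ, sup_eq_right.mpr (hJle Y hcY),
      sup_eq_right.mpr (hJle Z hcZ)] at h2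
    exact h2.ge
  have hmul : ∀ z ∈ Z, ∀ y ∈ T, ∃ x ∈ T, z * y = algebraMap R Λ c * x := by
    intro z hz y hy
    let Y : Submodule Λ Λ :=
      { carrier := {z | z ∈ Z ∧ ∃ x ∈ T, z * y = algebraMap R Λ c * x}
        zero_mem' := ⟨zero_mem _, 0, zero_mem _, by simp⟩
        add_mem' := by
          rintro a b ⟨ha, x, hx, h1⟩ ⟨hb, x', hx', h2⟩
          exact ⟨add_mem ha hb, x + x', add_mem hx hx', by rw [add_mul, h1, h2, mul_add]⟩
        smul_mem' := by
          rintro l a ⟨ha, x, hx, h1⟩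
          refine ⟨Z.smul_mem l ha, l * x, T.smul_mem l hx, ?_⟩
          rw [smul_eq_mul, mul_assoc, h1, ← mul_assoc, ← mul_assoc, Algebra.commutes] }
    let α : Z →ₗ[Λ] T := LinearMap.codRestrict T (LinearMap.toSpanSingleton Λ Λ y ∘ₗ Z.subtype)
      fun z => T.smul_mem z hy
    let β : T →ₗ[Λ] T :=
      { toFun := fun x => algebraMap R Λ c • x
        map_add' := smul_add _
        map_smul' := fun l x => by
          rw [RingHom.id_apply, smul_smul, smul_smul, Algebra.commutes] }
    -- The elements `z` of `Z` with `z y ∈ cT` form the pullback of `α` and the injective map `β`,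
    -- hence a kernel in the class. This ideal contains `c`, so by minimality it is all of `Z`,
    -- giving `ZT ⊆ cT`.
    let f : Z × T →ₗ[Λ] T := α.coprod (-β)
    have hfmem : ∀ p : Z × T, f p = 0 ↔ (p.1 : Λ) * y = algebraMap R Λ c * (p.2 : Λ) := by
      intro p
      have h1 : f p = α p.1 - β p.2 := by simp [f, sub_eq_add_neg]
      rw [h1, sub_eq_zero, Subtype.ext_iff]
      rfl
    have hYmem : D.mem Y := by
      let e : LinearMap.ker f →ₗ[Λ] Y := LinearMap.codRestrict Y
        (Z.subtype ∘ₗ LinearMap.fst Λ Z T ∘ₗ (LinearMap.ker f).subtype) fun p =>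
          ⟨p.1.1.2, p.1.2, p.1.2.2, (hfmem p.1).mp p.2⟩
      refine of_equiv (hD.mem_ker hT.1 (D.prod hZ hT.1) f) (LinearEquiv.ofBijective e ⟨?_, ?_⟩)
      · rintro ⟨⟨a, x⟩, h1⟩ ⟨⟨b, x'⟩, h2⟩ hab
        have hab' : a = b := Subtype.ext (congrArg (Subtype.val : Y → Λ) hab)
        subst hab'
        have h3 := (hfmem _).mp h1
        have h4 := (hfmem _).mp h2
        have h5 : algebraMap R Λ c • x = algebraMap R Λ c • x' := Subtype.ext (h3.symm.trans h4)
        have h6 := smul_injective_of_mem hT.1 hc h5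
        subst h6
        rfl
      · rintro ⟨a, ha, x, hx, h⟩
        exact ⟨⟨(⟨a, ha⟩, ⟨x, hx⟩), (hfmem _).mpr h⟩, rfl⟩
    exact (hleast Y hYmem (fun z hz => hz.1) ⟨hcZ, y, hy, rfl⟩ hz).2
  refine ⟨Z, hZ, fun a => ⟨fun ha => ?_, ?_⟩⟩
  · obtain ⟨r, l, hr, hl⟩ := exists_smul_eq_tmul_one (R := R) a
    obtain ⟨z, hz⟩ := hD.stabilizes hT.1 hc hcT (mem_leftOrder_iff.mp ha) Z hZ r l hr hl ⟨_, hcZ⟩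
    refine ⟨z, z.2, smul_tensor_injective hr ?_⟩
    have hz' : algebraMap R Λ r * (z : Λ) = l * algebraMap R Λ c := congrArg Subtype.val hz
    rw [← algebraMap_mul_tmul_one, hz', ← Algebra.commutes, algebraMap_mul_tmul_one, ← hl,
      smul_comm]
  · rintro ⟨z, hz, h⟩ y hy
    obtain ⟨x, hx, hzx⟩ := hmul z hz y hy
    refine ⟨x, hx, smul_tensor_injective hc ?_⟩
    rw [← smul_mul_assoc, h, tmul_one_mul_tmul_one, hzx, algebraMap_mul_tmul_one]

variable (K) in
/-- A lattice over the left order of the trace of a terminal class belongs to the class. -/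
theorem IsTerminal.mem_of_smul (hss : IsSemisimpleRing (Λ ⊗[R] K)) (hD : D.IsTerminal)
    {Z : Submodule Λ Λ} (hZ : D.mem Z) {c : R} (hc : c ≠ 0) (hcZ : algebraMap R Λ c ∈ Z)
    {N : Type u} [AddCommGroup N] [Module R N] [Module Λ N] [IsScalarTower R Λ N]
    [Module.Finite R N] [Module.IsTorsionFree R N] (h : ∀ z ∈ Z, ∀ x : N, ∃ y : N, z • x = c • y) :
    D.mem N := by
  have _ : IsNoetherianRing Λ := isNoetherian_of_tower R inferInstance
  have hinj : ∀ {x y : N}, c • x = c • y → x = y := fun h => smul_right_injective N hc h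
  choose f hf using h
  have hgen : ∀ U : Submodule R N, U.FG → ∃ (W : Type u) (_ : AddCommGroup W) (_ : Module Λ W)
      (F : W →ₗ[Λ] N), D.mem W ∧ ∀ x ∈ U, ∃ w, F w = x := by
    intro U hU
    induction U, hU using Submodule.fg_induction with
    | singleton x =>
      -- The map `z ↦ c⁻¹ z x`, which takes `c` to `x`; finitely many of these cover `N`.
      let F : Z →ₗ[Λ] N :=
        { toFun := fun z => f z z.2 x
          map_add' := fun a b => hinj (by
            rw [smul_add, ← hf, ← hf, ← hf, ← add_smul]
            rfl)
          map_smul' := fun l a => hinj (by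
            rw [← hf, RingHom.id_apply, smul_comm, ← hf, ← mul_smul]
            rfl) }
      have hF : F ⟨_, hcZ⟩ = x := hinj (by
        change c • f _ hcZ x = _
        rw [← hf, algebraMap_smul])
      refine ⟨Z, _, _, F, hZ, fun y hy => ?_⟩
      obtain ⟨s, rfl⟩ := Submodule.mem_span_singleton.mp hy
      exact ⟨s • (⟨_, hcZ⟩ : Z), (map_smul_base F s _).trans (by rw [hF])⟩
    | sup U₁ U₂ _ _ h₁ h₂ =>
      obtain ⟨W, _, _, F, hW, h₁⟩ := h₁
      obtain ⟨W', _, _, F', hW', h₂⟩ := h₂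
      refine ⟨W × W', _, _, F.coprod F', D.prod hW hW', fun x hx => ?_⟩
      obtain ⟨a, ha, b, hb, rfl⟩ := Submodule.mem_sup.mp hx
      obtain ⟨w, rfl⟩ := h₁ a ha
      obtain ⟨w', rfl⟩ := h₂ b hb
      exact ⟨(w, w'), rfl⟩
  obtain ⟨W, _, _, F, hW, hF⟩ := hgen ⊤ Module.Finite.fg_top
  have hF' : Function.Surjective F := fun x => hF x trivial
  have _ := D.finite hW
  have _ := D.projective hW
  let _ : Module R W := Module.compHom W (algebraMap R Λ)
  have _ : IsScalarTower R Λ W := IsScalarTower.of_algebraMap_smul fun _ _ => rfl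
  have _ : Module.Finite R W := Module.Finite.trans Λ W
  have _ := isTorsionFree_of_projective R Λ W
  -- The section up to a scalar is an embedding of `N` into `W`, so `N` is isomorphic to the image
  -- of the endomorphism `s ∘ F` of `W`, and images stay in the class.
  obtain ⟨r, s, hr, hs⟩ := exists_section_up_to_scalar K hss F hF'
  have hsinj : Function.Injective s := fun x y hxy =>
    smul_right_injective N hr (by change r • x = r • y; rw [← hs, ← hs, hxy])
  obtain ⟨V, _, _, g, m, hV, hg, hm, hgm⟩ := hD.exists_factorization hW hW (s ∘ₗ F)
  have hker : LinearMap.ker F = LinearMap.ker g := by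
    ext w
    rw [LinearMap.mem_ker, LinearMap.mem_ker, ← map_eq_zero_iff m hm, ← hgm, LinearMap.comp_apply,
      map_eq_zero_iff s hsinj]
  exact of_equiv hV ((g.quotKerEquivOfSurjective hg).symm ≪≫ₗ Submodule.quotEquivOfEq _ _ hker.symm
    ≪≫ₗ F.quotKerEquivOfSurjective hF')

end Order

end PrSub

/-! ### Extending scalars to a stabilizing order. -/

section StableModule

variable {R : Type u₁} [CommRing R] [IsDomain R] [IsPrincipalIdealRing R] {K : Type u₂} [Field K]
  [Algebra R K] [IsFractionRing R K] {Λ : Type u} [Ring Λ] [Algebra R Λ] [Module.Finite R Λ]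
  [Module.IsTorsionFree R Λ] {M : Type*} [AddCommGroup M] [Module Λ M]

/-- The quotient `y` does not depend on the fraction: two fractions for `a` can be compared by
cross-multiplication, and `M` is torsion-free. -/
theorem Stabilizes.exists_forall {a : Λ ⊗[R] K} (ha : Stabilizes a M)
    (hM : ∀ r : R, r ≠ 0 → Function.Injective fun x : M => algebraMap R Λ r • x) (x : M) :
    ∃ y : M, ∀ (r : R) (l : Λ), r ≠ 0 → r • a = l ⊗ₜ[R] (1 : K) → algebraMap R Λ r • y = l • x := by
  obtain ⟨s, m, hs, hm⟩ := exists_smul_eq_tmul_one (R := R) a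
  obtain ⟨y, hy⟩ := ha s m hs hm x
  refine ⟨y, fun r l hr hl => hM s hs ?_⟩
  have h : algebraMap R Λ s * l = algebraMap R Λ r * m := (tmul_one_inj (R := R) (K := K)).mp (by
    rw [algebraMap_mul_tmul_one, algebraMap_mul_tmul_one, ← hl, ← hm, smul_comm])
  change algebraMap R Λ s • algebraMap R Λ r • y = algebraMap R Λ s • l • x
  rw [smul_smul, smul_smul, h, Algebra.commutes, mul_smul, hy, mul_smul]

/-- A torsion-free module stabilized by the members of an order is a module over that order. -/
theorem exists_module_of_stabilizes (S : Subalgebra R (Λ ⊗[R] K))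
    (hS : ∀ a ∈ S, Stabilizes a M)
    (hM : ∀ r : R, r ≠ 0 → Function.Injective fun x : M => algebraMap R Λ r • x) :
    ∃ _ : Module S M, ∀ (a : S) (l : Λ) (x : M), (a : Λ ⊗[R] K) = l ⊗ₜ[R] (1 : K) →
      a • x = l • x := by
  choose s hs using fun (a : S) (x : M) => (hS a a.2).exists_forall hM x
  -- One fraction suffices to identify `s a x`, so each module axiom reduces to an identity between
  -- fractions with a suitable denominator.
  have hu : ∀ (a : S) (x y : M) (r : R) (l : Λ), r ≠ 0 → r • (a : Λ ⊗[R] K) = l ⊗ₜ[R] (1 : K) →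
      algebraMap R Λ r • y = l • x → s a x = y := fun a x y r l hr hl h =>
    hM r hr ((hs a x r l hr hl).trans h.symm)
  have h1 : ∀ (a : S) (l : Λ) (x : M), (a : Λ ⊗[R] K) = l ⊗ₜ[R] (1 : K) → s a x = l • x :=
    fun a l x h => hu a x _ 1 l one_ne_zero (by rw [one_smul, h]) (by rw [map_one, one_smul])
  have hden : ∀ a : S, ∃ (r : R) (l : Λ), r ≠ 0 ∧ r • (a : Λ ⊗[R] K) = l ⊗ₜ[R] (1 : K) :=
    fun a => exists_smul_eq_tmul_one (R := R) (a : Λ ⊗[R] K)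
  refine ⟨{ smul := s, one_smul := fun x => ?_, mul_smul := fun a b x => ?_, smul_zero := ?_,
            smul_add := ?_, add_smul := ?_, zero_smul := ?_ }, h1⟩
  · obtain ⟨r, l, hr, hl⟩ := hden a
    obtain ⟨t, m, ht, hm⟩ := hden b
    refine hu _ _ _ (t * r) (l * m) (mul_ne_zero ht hr) ?_ ?_
    · rw [← tmul_one_mul_tmul_one, ← hl, ← hm, smul_mul_smul_comm, mul_comm t r]
      rfl
    · change algebraMap R Λ (t * r) • s a (s b x) = _
      rw [map_mul, mul_smul, hs a (s b x) r l hr hl, smul_smul, Algebra.commutes, mul_smul,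
        hs b x t m ht hm, mul_smul]
  · exact (h1 1 1 x rfl).trans (one_smul Λ x)
  · intro a
    obtain ⟨r, l, hr, hl⟩ := hden a
    exact hu _ _ _ r l hr hl (by rw [smul_zero, smul_zero])
  · intro a x y
    obtain ⟨r, l, hr, hl⟩ := hden a
    exact hu _ _ _ r l hr hl (by
      rw [smul_add, smul_add]
      exact congrArg₂ _ (hs a x r l hr hl) (hs a y r l hr hl))
  · intro a b x
    obtain ⟨r, l, hr, hl⟩ := hden a
    obtain ⟨t, m, ht, hm⟩ := hden b
    refine hu _ _ _ (t * r) (algebraMap R Λ t * l + algebraMap R Λ r * m) (mul_ne_zero ht hr) ?_ ?_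
    · rw [TensorProduct.add_tmul, algebraMap_mul_tmul_one, algebraMap_mul_tmul_one, ← hl, ← hm,
        smul_smul, smul_smul, mul_comm r t, ← smul_add]
      rfl
    · rw [smul_add, add_smul, mul_smul _ l, map_mul]
      refine congrArg₂ _ ?_ ?_
      · rw [mul_smul]
        exact congrArg (algebraMap R Λ t • ·) (hs a x r l hr hl)
      · rw [Algebra.commutes, mul_smul, mul_smul]
        exact congrArg (algebraMap R Λ r • ·) (hs b x t m ht hm)
  · intro x
    exact (h1 0 0 x (TensorProduct.zero_tmul _ _).symm).trans (zero_smul Λ x)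

end StableModule

namespace Overorder

variable {R : Type u₁} [CommRing R] [IsDomain R] [IsPrincipalIdealRing R] {K : Type u₂} [Field K]
  [Algebra R K] [IsFractionRing R K] {Λ : Type u} [Ring Λ] [Algebra R Λ] [Module.Finite R Λ]
  [Module.IsTorsionFree R Λ] (Γ : Overorder R K Λ)

theorem lat_of_stabilizes (X : ModuleCat.{u} Λ) [Module.Finite Λ X] [Module.Projective Λ X]
    (hX : ∀ a ∈ Γ.carrier, Stabilizes a X) : Γ.lat X := by
  let _ : Module R X := Module.compHom X (algebraMap R Λ)
  have _ : IsScalarTower R Λ X := IsScalarTower.of_algebraMap_smul fun _ _ => rfl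
  have _ : Module.Finite R X := Module.Finite.trans Λ X
  have _ := isTorsionFree_of_projective R Λ X
  obtain ⟨_, hmod⟩ := exists_module_of_stabilizes Γ.carrier hX fun r hr x y h =>
    smul_right_injective X hr h
  let M : ModuleCat.{u} Γ.carrier := ModuleCat.of Γ.carrier X
  let e : X ≃ₗ[R] (ModuleCat.restrictScalars (algebraMap R Γ.carrier)).obj M :=
    { AddEquiv.refl X with
      map_smul' := fun r x => (hmod (algebraMap R Γ.carrier r) (algebraMap R Λ r) x rfl).symm }
  let f : X ≃ₗ[Λ] (ModuleCat.restrictScalars Γ.fromBase).obj M :=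
    { AddEquiv.refl X with
      map_smul' := fun l x => (hmod (Γ.fromBase l) l x rfl).symm }
  exact ⟨M, ⟨Module.Finite.equiv e, Module.Projective.of_equiv e⟩, ⟨f.toModuleIso⟩⟩

end Overorder

/-! ### Lattices and maximality. -/

namespace PrSub

variable {R : Type u₁} [CommRing R] [IsDomain R] [IsPrincipalIdealRing R]
  {K : Type u₂} [Field K] [Algebra R K] [IsFractionRing R K]
  {Λ : Type u} [Ring Λ] [Algebra R Λ] [Module.Finite R Λ] [Module.IsTorsionFree R Λ]
  {D : PrSub Λ}

theorem IsTerminal.mem_of_lat (hss : IsSemisimpleRing (Λ ⊗[R] K)) (hD : D.IsTerminal)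
    {Z : Submodule Λ Λ} (hZ : D.mem Z) {c : R} (hc : c ≠ 0) (hcZ : algebraMap R Λ c ∈ Z)
    (Γ : Overorder R K Λ) (hΓ : ∀ z ∈ Z, ∃ a ∈ Γ.carrier, c • a = z ⊗ₜ[R] (1 : K))
    (X : ModuleCat.{u} Λ) (hX : Γ.lat X) : D.mem X := by
  obtain ⟨M, ⟨hfin, hproj⟩, ⟨e⟩⟩ := hX
  let _ : Module Λ M := Module.compHom M Γ.fromBase
  let _ : Module R M := Module.compHom M (algebraMap R Γ.carrier)
  have _ : IsScalarTower R Λ M := IsScalarTower.of_algebraMap_smul fun _ _ => rfl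
  have _ : Module.Finite R M := hfin
  have _ : Module.Projective R M := hproj
  have _ := isTorsionFree_of_projective R R M
  refine of_equiv (M := M) (hD.mem_of_smul K hss hZ hc hcZ fun z hz x => ?_) e.toLinearEquiv.symm
  obtain ⟨a, ha, h⟩ := hΓ z hz
  refine ⟨(⟨a, ha⟩ : Γ.carrier) • x, ?_⟩
  change Γ.fromBase z • x = algebraMap R Γ.carrier c • (⟨a, ha⟩ : Γ.carrier) • x
  rw [smul_smul]
  congr 1
  refine Subtype.ext (h.symm.trans ?_)
  rw [Algebra.smul_def]
  rfl

/-- This gives maximality. A multiple of a larger order `S` is a left ideal stable under `S`; it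
lies in the class as a lattice over the smaller order, so `S` stabilizes every member of the class,
in particular `T`. -/
theorem IsTerminal.le_leftOrder (hss : IsSemisimpleRing (Λ ⊗[R] K)) (hD : D.IsTerminal)
    {T Z : Submodule Λ Λ} (hT : D.mem T) (hZ : D.mem Z) {c : R} (hc : c ≠ 0)
    (hcZ : algebraMap R Λ c ∈ Z) (S : Subalgebra R (Λ ⊗[R] K)) (hS : S.toSubmodule.FG)
    (hZS : ∀ z ∈ Z, ∃ a ∈ S, c • a = z ⊗ₜ[R] (1 : K)) (hΛ : ∀ l : Λ, l ⊗ₜ[R] (1 : K) ∈ S) :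
    S ≤ leftOrder R K T := by
  have _ : IsNoetherianRing Λ := isNoetherian_of_tower R inferInstance
  obtain ⟨r, hr, hrS⟩ := exists_common_denominator S.toSubmodule hS
  -- The left ideal `rS`, where `r` is a common denominator of `S`; it has full rank because it
  -- contains `r`.
  let G : Submodule Λ Λ :=
    { carrier := {l | ∃ a ∈ S, r • a = l ⊗ₜ[R] (1 : K)}
      zero_mem' := ⟨0, zero_mem S, by rw [smul_zero, TensorProduct.zero_tmul]⟩
      add_mem' := by
        rintro l m ⟨a, ha, hl⟩ ⟨b, hb, hm⟩
        exact ⟨a + b, add_mem ha hb, by rw [smul_add, hl, hm, TensorProduct.add_tmul]⟩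
      smul_mem' := by
        rintro x l ⟨a, ha, hl⟩
        exact ⟨_, mul_mem (hΛ x) ha, by
          rw [← mul_smul_comm, hl, tmul_one_mul_tmul_one, smul_eq_mul]⟩ }
  have hrG : algebraMap R Λ r ∈ G := ⟨1, one_mem S, by
    rw [← mul_one (algebraMap R Λ r), algebraMap_mul_tmul_one, Algebra.TensorProduct.one_def]⟩
  have _ : Module.Finite R G :=
    Module.Finite.of_injective (G.subtype.restrictScalars R) G.injective_subtype
  have _ : Module.IsTorsionFree R G :=
    G.injective_subtype.moduleIsTorsionFree G.subtype fun _ _ => rfl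
  have hG : D.mem G := by
    refine hD.mem_of_smul K hss hZ hc hcZ fun z hz x => ?_
    obtain ⟨a, ha, h⟩ := hZS z hz
    obtain ⟨b, hb, hx⟩ := x.2
    obtain ⟨y, hy⟩ := hrS _ (show a * b ∈ S from mul_mem ha hb)
    refine ⟨⟨y, _, mul_mem ha hb, hy⟩, Subtype.ext ((tmul_one_inj (R := R) (K := K)).mp ?_)⟩
    change (z * (x : Λ)) ⊗ₜ[R] (1 : K) = (c • y) ⊗ₜ[R] (1 : K)
    rw [← tmul_one_mul_tmul_one, ← h, ← hx, ← TensorProduct.smul_tmul', ← hy, smul_mul_assoc,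
      mul_smul_comm]
  intro a ha
  refine mem_leftOrder_iff.mpr (hD.stabilizes hG hr hrG (fun t l ht hl x => ?_) T hT)
  obtain ⟨b, hb, hx⟩ := x.2
  obtain ⟨y, hy⟩ := hrS _ (show a * b ∈ S from mul_mem ha hb)
  refine ⟨⟨y, _, mul_mem ha hb, hy⟩, Subtype.ext ((tmul_one_inj (R := R) (K := K)).mp ?_)⟩
  change (algebraMap R Λ t * y) ⊗ₜ[R] (1 : K) = (l * (x : Λ)) ⊗ₜ[R] (1 : K)
  rw [algebraMap_mul_tmul_one, ← tmul_one_mul_tmul_one, ← hl, ← hx, ← hy, smul_mul_assoc,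
    mul_smul_comm]

end PrSub

/-! ### The case of orders and the main theorem. -/

theorem exists_maximalOverorder_hasRightRejectiveChain (R : Type u₁) [CommRing R] [IsDomain R]
    [IsDiscreteValuationRing R] [IsAdicComplete (IsLocalRing.maximalIdeal R) R]
    (K : Type u₂) [Field K] [Algebra R K] [IsFractionRing R K]
    (Λ : Type u) [Ring Λ] [Algebra R Λ] (hΛ : IsROrder R Λ)
    (hss : IsSemisimpleRing (Λ ⊗[R] K)) (hgl : GlobalDimLE Λ 2) :
    ∃ Γ : Overorder R K Λ, Γ.IsMaximalOrder ∧
      Γ.lat ≤ prProperty Λ ∧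
      HasRightRejectiveChain (Pr Λ) (Γ.lat.inverseImage (prProperty Λ).ι) := by
  obtain ⟨_, _⟩ := hΛ
  have _ := isTorsionFree_of_projective R R Λ
  have _ : IsNoetherianRing Λ := isNoetherian_of_tower R inferInstance
  obtain ⟨D, hDr, hD, c, T, hc, hT, hcT⟩ := PrSub.exists_reachable_isTerminal K hss hgl
  obtain ⟨Z, hZ, hZT⟩ := hD.exists_multiple_of_leftOrder (K := K) hT hc hcT
  have hcZ : algebraMap R Λ c ∈ Z := by
    obtain ⟨z, hz, h⟩ := (hZT 1).mp (one_mem _)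
    rw [Algebra.TensorProduct.one_def, ← algebraMap_mul_tmul_one, mul_one, tmul_one_inj] at h
    rwa [h]
  -- Together with `hZT` this says that `Z` is exactly `c` times the left order of `T`.
  have hZΓ : ∀ z ∈ Z, ∃ a ∈ leftOrder R K T, c • a = z ⊗ₜ[R] (1 : K) := by
    intro z hz
    obtain ⟨a, ha⟩ := exists_smul_eq hc (z ⊗ₜ[R] (1 : K))
    exact ⟨a, (hZT a).mpr ⟨z, hz, ha⟩, ha⟩
  let Γ : Overorder R K Λ :=
    { carrier := leftOrder R K T
      isROrder := isROrder_of_smul_mem _ hc fun a ha => by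
        obtain ⟨z, -, h⟩ := (hZT a).mp ha
        exact ⟨z, h⟩
      le := by
        rintro _ ⟨l, rfl⟩
        exact tmul_one_mem_leftOrder T l }
  have hlat : ∀ X : ModuleCat.{u} Λ, Γ.lat X ↔ D.mem X := by
    refine fun X => ⟨hD.mem_of_lat hss hZ hc hcZ Γ hZΓ X, fun hX => ?_⟩
    have _ := D.finite hX
    have _ := D.projective hX
    exact Γ.lat_of_stabilizes X fun a ha =>
      hD.stabilizes hT.1 hc hcT (mem_leftOrder_iff.mp ha) X hX
  refine ⟨Γ, fun S hS hle => le_antisymm ?_ hle, fun X hX => ?_, ?_⟩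
  · refine hD.le_leftOrder hss hT.1 hZ hc hcZ S (Module.Finite.iff_fg.mp hS.1) (fun z hz => ?_)
      fun l => hle (tmul_one_mem_leftOrder T l)
    obtain ⟨a, ha, h⟩ := hZΓ z hz
    exact ⟨a, hle ha, h⟩
  · exact ⟨D.finite ((hlat X).mp hX), D.projective ((hlat X).mp hX)⟩
  · convert hDr.hasRightRejectiveChain using 1
    ext X
    exact hlat X.obj

theorem mainTheorem9 :
    (∀ (k : Type u₁) [CommRing k] [IsArtinianRing k] (Λ : Type u) [Ring Λ] [Algebra k Λ]
      [Module.Finite k Λ],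
      GlobalDimLE Λ 2 →
      HasRightRejectiveChain (Pr Λ) (fun X => IsZero X)) ∧
    (∀ (R : Type u₁) [CommRing R] [IsDomain R] [IsDiscreteValuationRing R]
      [IsAdicComplete (IsLocalRing.maximalIdeal R) R]
      (K : Type u₂) [Field K] [Algebra R K] [IsFractionRing R K]
      (Λ : Type u) [Ring Λ] [Algebra R Λ],
      IsROrder R Λ → IsSemisimpleRing (Λ ⊗[R] K) →
      GlobalDimLE Λ 2 →
      ∃ Γ : Overorder R K Λ, Γ.IsMaximalOrder ∧
        Γ.lat ≤ prProperty Λ ∧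
        HasRightRejectiveChain (Pr Λ) (Γ.lat.inverseImage (prProperty Λ).ι)) := by
  exact ⟨fun k _ _ Λ _ _ _ hgl => hasRightRejectiveChain_of_isArtinianRing k Λ hgl,
    fun R _ _ _ _ K _ _ _ Λ _ _ hΛ hss hgl =>
      exists_maximalOverorder_hasRightRejectiveChain R K Λ hΛ hss hgl⟩
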